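/- Let $M$ be a smooth Hausdorff manifold modelled on a real Banach space $E$. Let $T^0M=M$, $T^{r+1}M=T(T^rM)$, with projections $\pi_r:T^{r+1}M\to T^rM$. Let $\kappa_1=\mathrm{id}_{TM}$ and, for $r\ge 2$, let $\kappa_r:T^rM\to T^rM$ be the canonical involution, given in the charts induced by those of $M$ by $(x,y,X,Y)\mapsto(x,X,y,Y)$. The complete lift of a (smooth) vector field $A$ on $T^rM$ is the vector field $A^c=D\kappa_{r+1}\circ\kappa_{r+2}\circ DA\circ\kappa_{r+1}$ on $T^{r+1}M$. For a vector field $X$ on $TM$ put $X^{c_0}=X$ and $X^{c_{i+1}}=(X^{c_i})^c$, a vector field on $T(T^iM)=T^{i+1}M$, with flow $F^{c_i}$. Let $T(T^\infty M)=\varprojlim\,(T(T^iM),D\pi_i)$, a manifold modelled on a Fréchet space by the projective limits of the charts induced by the charts of $M$, let $T^2(T^\infty M)=\varprojlim\,(T^2(T^iM),D^2\pi_i)$, and let $X^{c_\infty}=\varprojlim X^{c_i}:T(T^\infty M)\to T^2(T^\infty M)$. For $\xi=(\xi_i)_{i\ge 0}\in T(T^\infty M)$ let $I(\xi)$ be the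 set of all $t\in\mathbb R$ which, for every $i$, lie in the domain of the maximal integral curve $F^{c_i}_{\xi_i}$ of $X^{c_i}$ through $\xi_i$. (1) For every vector field $X$ on $TM$ and every $\xi=(\xi_i)\in T(T^\infty M)$, the set $I(\xi)$ is an open interval containing $0$, the limit $F^{c_\infty}_\xi=\varprojlim F^{c_i}_{\xi_i}:I(\xi)\to T(T^\infty M)$ exists, and it is a smooth integral curve of $X^{c_\infty}$ with $F^{c_\infty}_\xi(0)=\xi$. It is unique: every integral curve $\delta:J\to T(T^\infty M)$ of $X^{c_\infty}$ on an open interval $J\ni 0$ with $\delta(0)=\xi$ satisfies $J\subseteq I(\xi)$ and $\delta=F^{c_\infty}_\xi|_J$. (2) If $X$ is a complete vector field on $TM$ (all its integral curves extend to $\mathbb R$), then $X^{c_\infty}$ is a complete vector field on $T(T^\infty M)$. In particular, if $Y$ is a complete vector field on $M$, then $(Y^c)^{c_\infty}$ is complete. -/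

import Mathlib

open scoped Manifold ContDiff Topology
open Set Filter

universe u

section CanonicalFlip
variable {E : Type u} [NormedAddCommGroup E] [NormedSpace ℝ E] {H : Type u} [TopologicalSpace H]
  (I : ModelWithCorners ℝ E H) {N : Type u} [TopologicalSpace N] [ChartedSpace H N]
  [IsManifold I ∞ N]

/-- The canonical involution of `T(TN)`, `(x, y, X, Y) ↦ (x, X, y, Y)`. In Mathlib a tangent vector
at `x` is stored through its coordinates in the preferred chart at `x`, and the preferred chart of
`TN` at a point over `x` is the one induced by the preferred chart of `N` at `x`; so the components
used here are coordinates with respect to one chart of `N`. That the local representation is the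
same in every induced chart is `extChartAt_flipRaw`. -/
def flipRaw (v : TangentBundle I.tangent (TangentBundle I N)) :
    TangentBundle I.tangent (TangentBundle I N) :=
  ⟨⟨v.1.1, (v.2 : E × E).1⟩, ((v.1.2 : E), (v.2 : E × E).2)⟩

variable [I.Boundaryless]

theorem contDiffAt_extChart_change (x x' : N) (h : x' ∈ (extChartAt I x).source) :
    ContDiffAt ℝ ∞ (extChartAt I x ∘ (extChartAt I x').symm) (extChartAt I x' x') := by
  have h1 := contDiffWithinAt_ext_coord_change (n := ∞) (I := I) x x'
    (y := extChartAt I x' x') (by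
      rw [PartialEquiv.trans_source'', PartialEquiv.symm_symm, PartialEquiv.symm_target]
      exact Set.mem_image_of_mem _ ⟨mem_extChartAt_source _, h⟩)
  rwa [I.range_eq_univ, contDiffWithinAt_univ] at h1

theorem extChartAt_tangent_tangent (v : TangentBundle I.tangent (TangentBundle I N))
    (x' : N) (y X Y : E) (h : x' ∈ (extChartAt I v.1.1).source) :
    extChartAt I.tangent.tangent v ⟨⟨x', y⟩, (X, Y)⟩ =
      let ψ := extChartAt I v.1.1 ∘ (extChartAt I x').symm
      let a := extChartAt I x' x'
      ((extChartAt I v.1.1 x', fderiv ℝ ψ a y),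
        (fderiv ℝ ψ a X, fderiv ℝ (fderiv ℝ ψ) a X y + fderiv ℝ ψ a Y)) := by
  let ψ := extChartAt I v.1.1 ∘ (extChartAt I x').symm
  let a := extChartAt I x' x'
  change _ = ((extChartAt I v.1.1 x', fderiv ℝ ψ a y),
        (fderiv ℝ ψ a X, fderiv ℝ (fderiv ℝ ψ) a X y + fderiv ℝ ψ a Y))
  have hψ : ContDiffAt ℝ ∞ ψ a := contDiffAt_extChart_change I v.1.1 x' h
  have hd : DifferentiableAt ℝ ψ a := hψ.differentiableAt (by simp)
  have hd2 : DifferentiableAt ℝ (fderiv ℝ ψ) a :=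
    (hψ.fderiv_right (m := 1) (by norm_cast)).differentiableAt (by simp)
  let w : TangentBundle I N := ⟨x', y⟩
  have key : (extChartAt I.tangent v.1 ∘ (extChartAt I.tangent w).symm) =ᶠ[𝓝 (a, y)]
      fun e : E × E => (ψ e.1, fderiv ℝ ψ e.1 e.2) := by
    have h1 : ∀ᶠ e : E × E in 𝓝 (a, y), e.1 ∈ (extChartAt I x').target :=
      continuous_fst.continuousAt.eventually (extChartAt_target_mem_nhds (I := I) x')
    have h0 : ∀ᶠ e : E in 𝓝 a, (extChartAt I x').symm e ∈ (extChartAt I v.1.1).source :=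
      (continuousAt_extChartAt_symm (I := I) x').eventually (by
        rw [extChartAt_to_inv]; exact extChartAt_source_mem_nhds' h)
    have h2 : ∀ᶠ e : E × E in 𝓝 (a, y),
        (extChartAt I x').symm e.1 ∈ (extChartAt I v.1.1).source :=
      (continuous_fst.continuousAt (x := (a, y))).eventually h0
    filter_upwards [h1, h2] with e he1 he2
    rw [Function.comp_apply]
    refine Prod.ext rfl ?_
    have h3 := tangentCoordChange_comp (I := I) (w := x') (x := (extChartAt I x').symm e.1)
      (y := v.1.1) (z := (extChartAt I x').symm e.1) (v := e.2)
      ⟨⟨(extChartAt I x').map_target he1, mem_extChartAt_source _⟩, he2⟩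
    refine Eq.trans (show _ = _ from h3) ?_
    rw [tangentCoordChange_def, I.range_eq_univ, fderivWithin_univ,
      (extChartAt I x').right_inv he1]
  have hF : HasFDerivAt (fun e : E × E => (ψ e.1, fderiv ℝ ψ e.1 e.2))
      (((fderiv ℝ ψ a).comp (ContinuousLinearMap.fst ℝ E E)).prod
        ((fderiv ℝ ψ a).comp (ContinuousLinearMap.snd ℝ E E) +
          ((fderiv ℝ (fderiv ℝ ψ) a).comp (ContinuousLinearMap.fst ℝ E E)).flip y))
      (a, y) := by
    refine HasFDerivAt.prodMk ?_ ?_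
    · exact HasFDerivAt.comp (x := (a, y)) (g := ψ) hd.hasFDerivAt hasFDerivAt_fst
    · exact (HasFDerivAt.comp (x := (a, y)) (g := fderiv ℝ ψ)
        hd2.hasFDerivAt hasFDerivAt_fst).clm_apply hasFDerivAt_snd
  have hpt : extChartAt I.tangent w w = (a, y) :=
    Prod.ext rfl (tangentCoordChange_self (I := I) (mem_extChartAt_source _))
  have hcc : tangentCoordChange I.tangent w v.1 w (X, Y) =
      (fderiv ℝ ψ a X, fderiv ℝ (fderiv ℝ ψ) a X y + fderiv ℝ ψ a Y) := by
    rw [tangentCoordChange_def, I.tangent.range_eq_univ, fderivWithin_univ, hpt, key.fderiv_eq,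
      hF.fderiv]
    simp [add_comm]
  refine Prod.ext (Prod.ext rfl ?_) hcc
  refine Eq.trans (show _ = tangentCoordChange I x' v.1.1 x' y from rfl) ?_
  rw [tangentCoordChange_def, I.range_eq_univ, fderivWithin_univ]

/-- `(x, y, X, Y) ↦ (x, X, y, Y)` on the model space. -/
def swapRaw (e : (E × E) × (E × E)) : (E × E) × (E × E) := ((e.1.1, e.2.1), (e.1.2, e.2.2))

/-- The local representation of the canonical involution in induced charts. -/
theorem extChartAt_flipRaw (v w : TangentBundle I.tangent (TangentBundle I N))
    (h : w.1.1 ∈ (extChartAt I v.1.1).source) :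
    extChartAt I.tangent.tangent (flipRaw I v) (flipRaw I w) =
      swapRaw (extChartAt I.tangent.tangent v w) := by
  obtain ⟨⟨x', y⟩, ⟨X, Y⟩⟩ := w
  have hs := ((contDiffAt_extChart_change I v.1.1 x' h).isSymmSndFDerivAt (by
    rw [minSmoothness_of_isRCLikeNormedField]; norm_cast)).eq
  rw [show flipRaw I (⟨⟨x', y⟩, ⟨X, Y⟩⟩ : TangentBundle I.tangent (TangentBundle I N)) =
    ⟨⟨x', X⟩, ⟨y, Y⟩⟩ from rfl, extChartAt_tangent_tangent I v x' y X Y h]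
  refine (extChartAt_tangent_tangent I (flipRaw I v) x' X y Y h).trans ?_
  exact Prod.ext rfl (Prod.ext rfl (congrArg (· + _) (hs y X)))

theorem contMDiff_flipRaw : ContMDiff I.tangent.tangent I.tangent.tangent ∞ (flipRaw I (N := N)) := by
  intro v
  have hsrc : ∀ᶠ w in 𝓝 v, w ∈ (extChartAt I.tangent.tangent v).source :=
    extChartAt_source_mem_nhds v
  have hmem : ∀ x w : TangentBundle I.tangent (TangentBundle I N),
      w ∈ (extChartAt I.tangent.tangent x).source ↔ w.1.1 ∈ (extChartAt I x.1.1).source := by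
    intro x w
    simp only [extChartAt_source]
    rw [TangentBundle.mem_chart_source_iff, TangentBundle.mem_chart_source_iff]
  have heq : (flipRaw I (N := N)) =ᶠ[𝓝 v] ((extChartAt I.tangent.tangent (flipRaw I v)).symm ∘
      swapRaw ∘
      extChartAt I.tangent.tangent v) := by
    filter_upwards [hsrc] with w hw
    rw [hmem] at hw
    rw [Function.comp_apply, Function.comp_apply, ← extChartAt_flipRaw I v w hw]
    exact ((extChartAt I.tangent.tangent (flipRaw I v)).left_inv ((hmem (flipRaw I v) (flipRaw I w)).2 hw)).symm
  refine ContMDiffAt.congr_of_eventuallyEq ?_ heq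
  have hsw : ContDiff ℝ ∞ (swapRaw (E := E)) := by
    unfold swapRaw; fun_prop
  have e1 : ContMDiffAt I.tangent.tangent 𝓘(ℝ, (E × E) × (E × E)) ∞
      (extChartAt I.tangent.tangent v) v := contMDiffAt_extChartAt
  have e2 := hsw.contMDiff.contMDiffAt.comp v e1
  have hv : v.1.1 ∈ (extChartAt I v.1.1).source := mem_extChartAt_source _
  refine ContMDiffAt.comp (I' := 𝓘(ℝ, (E × E) × (E × E))) v ?_ e2
  rw [Function.comp_apply, ← extChartAt_flipRaw I v v hv]
  exact (contMDiffOn_extChartAt_symm (flipRaw I v)).contMDiffAt (extChartAt_target_mem_nhds _)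

end CanonicalFlip


/-- A smooth manifold without boundary, modelled on a real Banach space `E`. -/
structure BanachManifold where
  E : Type u
  [instNorm : NormedAddCommGroup E]
  [instSpace : NormedSpace ℝ E]
  [instComplete : CompleteSpace E]
  H : Type u
  [instTopH : TopologicalSpace H]
  I : ModelWithCorners ℝ E H
  [instBoundaryless : I.Boundaryless]
  carrier : Type u
  [instTop : TopologicalSpace carrier]
  [instCharted : ChartedSpace H carrier]
  [instManifold : IsManifold I ∞ carrier]

namespace BanachManifold

noncomputable section

attribute [instance] instNorm instSpace instComplete instTopH instBoundaryless instTop instCharted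
  instManifold

instance : CoeSort BanachManifold.{u} (Type u) := ⟨carrier⟩

/-- A manifold modelled on the Banach space `E`, as a `BanachManifold`. -/
@[reducible] def of (E : Type u) [NormedAddCommGroup E] [NormedSpace ℝ E] [CompleteSpace E]
    (M : Type u) [TopologicalSpace M] [ChartedSpace E M] [IsManifold 𝓘(ℝ, E) ∞ M] :
    BanachManifold.{u} where
  E := E
  H := E
  I := 𝓘(ℝ, E)
  carrier := M

/-- The tangent bundle `TN`, as a Banach manifold modelled on `E × E`. -/
@[reducible] def tangent (N : BanachManifold.{u}) : BanachManifold.{u} where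
  E := N.E × N.E
  H := ModelProd N.H N.E
  I := N.I.tangent
  carrier := TangentBundle N.I N.carrier

/-- Smooth maps between Banach manifolds. -/
abbrev Hom (N N' : BanachManifold.{u}) : Type u := C^∞⟮N.I, N.carrier; N'.I, N'.carrier⟯

/-- The projection `TN → N`. -/
def proj (N : BanachManifold.{u}) : Hom N.tangent N :=
  ⟨Bundle.TotalSpace.proj, Bundle.contMDiff_proj (TangentSpace N.I)⟩

/-- The tangent map `Df : TN → TN'` of a smooth map `f : N → N'`. -/
def D {N N' : BanachManifold.{u}} (f : Hom N N') : Hom N.tangent N'.tangent :=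
  ⟨tangentMap N.I N'.I f, f.contMDiff.contMDiff_tangentMap (by norm_cast)⟩

/-- The canonical involution of `T(TN)`. -/
def flip (N : BanachManifold.{u}) : Hom N.tangent.tangent N.tangent.tangent :=
  ⟨flipRaw N.I, contMDiff_flipRaw N.I⟩

/-- The coordinate of a tangent vector in the preferred chart at its base point. -/
def coord {N : BanachManifold.{u}} (v : N.tangent) : N.E := v.2

theorem D_comp {N N' N'' : BanachManifold.{u}} (g : Hom N' N'') (f : Hom N N') :
    D (g.comp f) = (D g).comp (D f) := by
  ext v : 1
  exact congrFun (tangentMap_comp (g.contMDiff.mdifferentiable (by simp))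
    (f.contMDiff.mdifferentiable (by simp))) v

theorem D_id (N : BanachManifold.{u}) : D (ContMDiffMap.id : Hom N N) = ContMDiffMap.id := by
  ext v : 1
  exact congrFun tangentMap_id v

theorem proj_D {N N' : BanachManifold.{u}} (f : Hom N N') (v : N.tangent) :
    N'.proj (D f v) = f (N.proj v) := rfl

theorem flip_flip (N : BanachManifold.{u}) : N.flip.comp N.flip = ContMDiffMap.id := rfl

/-- `Dπ = π ∘ κ`. -/
theorem D_proj_eq (N : BanachManifold.{u}) : D N.proj = N.tangent.proj.comp N.flip := by
  ext v : 1
  obtain ⟨p, V⟩ := v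
  have hd : MDifferentiableAt N.tangent.I N.I N.proj p :=
    N.proj.contMDiff.mdifferentiable (by simp) p
  have h1 : HasFDerivAt (writtenInExtChartAt N.tangent.I N.I p N.proj)
      (ContinuousLinearMap.fst ℝ N.E N.E) (extChartAt N.tangent.I p p) := by
    refine hasFDerivAt_fst.congr_of_eventuallyEq ?_
    have : ∀ᶠ e : N.E × N.E in 𝓝 (extChartAt N.tangent.I p p),
        e.1 ∈ (extChartAt N.I p.1).target :=
      continuous_fst.continuousAt.eventually (extChartAt_target_mem_nhds (I := N.I) p.1)
    filter_upwards [this] with e he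
    exact (extChartAt N.I p.1).right_inv he
  have h2 : mfderiv N.tangent.I N.I N.proj p = ContinuousLinearMap.fst ℝ N.E N.E := by
    rw [hd.mfderiv, N.tangent.I.range_eq_univ, fderivWithin_univ]
    exact h1.fderiv
  have h3 : mfderiv N.tangent.I N.I N.proj p V = (V : N.E × N.E).1 := by
    rw [h2]; rfl
  exact congrArg (Bundle.TotalSpace.mk p.1) h3

/-- Vector fields on a Banach manifold: smooth sections of the tangent bundle. -/
structure VectorField (N : BanachManifold.{u}) where
  toHom : Hom N N.tangent
  proj_toHom : ∀ x, N.proj (toHom x) = x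

/-- A vector field as a family of tangent vectors. -/
def VectorField.field {N : BanachManifold.{u}} (A : VectorField N) (x : N) : TangentSpace N.I x :=
  coord (A.toHom x)

/-- `γ`, restricted to the open interval `J ∋ 0`, is an integral curve of `A` starting at `x`. -/
structure VectorField.IsIntegralCurveFrom {N : BanachManifold.{u}} (A : VectorField N) (x : N)
    (γ : ℝ → N) (J : Set ℝ) : Prop where
  isOpen : IsOpen J
  ordConnected : J.OrdConnected
  zero_mem : (0 : ℝ) ∈ J
  initial : γ 0 = x
  integral : IsMIntegralCurveOn γ A.field J

/-- The lifetime `I(x)` of `x` under `A`: the union of the domains of all integral curves of `A`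
starting at `x`. -/
def VectorField.lifetime {N : BanachManifold.{u}} (A : VectorField N) (x : N) : Set ℝ :=
  {t | ∃ (γ : ℝ → N) (J : Set ℝ), A.IsIntegralCurveFrom x γ J ∧ t ∈ J}

open Classical in
/-- The flow `F_x(t)` of `A`: the value at `t` of an integral curve of `A` starting at `x` (on a
Hausdorff manifold it does not depend on the curve); the value `x` off the lifetime is
irrelevant. -/
noncomputable def VectorField.flow {N : BanachManifold.{u}} (A : VectorField N) (x : N) (t : ℝ) :
    N :=
  if h : t ∈ A.lifetime x then h.choose t else x

/-- `A` is complete: through every point there is an integral curve defined on all of `ℝ`. -/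
def VectorField.IsComplete {N : BanachManifold.{u}} (A : VectorField N) : Prop :=
  ∀ x, ∃ γ : ℝ → N, A.IsIntegralCurveFrom x γ univ

/-- If `A` is a section of `TN` then `Dk ∘ κ ∘ DA ∘ k` is a section of `T(TN)`. -/
theorem proj_lift (N : BanachManifold.{u}) (k : Hom N.tangent N.tangent)
    (hk : k.comp k = ContMDiffMap.id) (A : VectorField N) (ξ : N.tangent) :
    N.tangent.proj (D k (N.flip (D A.toHom (k ξ)))) = ξ := by
  have h1 : ∀ v, N.tangent.proj (N.flip v) = D N.proj v := fun v => by rw [D_proj_eq]; rfl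
  have h2 : N.proj.comp A.toHom = ContMDiffMap.id := by
    ext x : 1
    exact A.proj_toHom x
  calc N.tangent.proj (D k (N.flip (D A.toHom (k ξ))))
      = k (((D N.proj).comp (D A.toHom)) (k ξ)) := by rw [proj_D, h1]; rfl
    _ = (k.comp k) ξ := by rw [← D_comp, h2, D_id]; rfl
    _ = ξ := by rw [hk]; rfl

theorem DD_proj_lift (N : BanachManifold.{u}) (A : VectorField N.tangent)
    (ξ : N.tangent.tangent) :
    D (D N.proj) (D N.flip (N.tangent.flip (D A.toHom (N.flip ξ)))) = A.toHom (D N.proj ξ) := by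
  have h1 : (D N.flip).comp (D N.flip) = ContMDiffMap.id := by
    rw [← D_comp, flip_flip]; exact D_id _
  have h2 : (D N.tangent.proj).comp N.tangent.flip = N.tangent.tangent.proj := by
    rw [D_proj_eq]; rfl
  rw [D_proj_eq, D_comp]
  set w : N.tangent.tangent.tangent := D A.toHom (N.flip ξ) with hw
  calc D N.tangent.proj (((D N.flip).comp (D N.flip)) (N.tangent.flip w))
      = ((D N.tangent.proj).comp N.tangent.flip) w := by rw [h1]; rfl
    _ = N.tangent.tangent.proj w := by rw [h2]
    _ = A.toHom ((N.tangent.proj.comp N.flip) ξ) := rfl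

variable (M : BanachManifold.{u})

/-- The iterated tangent bundle `T^r M`. -/
def T : ℕ → BanachManifold.{u}
  | 0 => M
  | r + 1 => (T r).tangent

/-- The projection `π_r : T^{r+1} M → T^r M`. -/
def π (r : ℕ) : Hom (M.T (r + 1)) (M.T r) := (M.T r).proj

/-- The canonical involution `κ_r` of `T^r M`; `κ_1` is the identity of `TM` (and `κ_0`, which is
not used, that of `M`). -/
def κ : (r : ℕ) → Hom (M.T r) (M.T r)
  | 0 => ContMDiffMap.id
  | 1 => ContMDiffMap.id
  | r + 2 => (M.T r).flip

theorem κ_comp_κ : ∀ r, (M.κ r).comp (M.κ r) = ContMDiffMap.id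
  | 0 => rfl
  | 1 => rfl
  | r + 2 => (M.T r).flip_flip

theorem D_π (r : ℕ) : D (M.π r) = (M.π (r + 1)).comp (M.κ (r + 2)) := (M.T r).D_proj_eq

variable {M}

/-- The complete lift `A^c = Dκ_{r+1} ∘ κ_{r+2} ∘ DA ∘ κ_{r+1}` of a vector field `A` on `T^r M`, a
vector field on `T^{r+1} M`. -/
def completeLift {r : ℕ} (A : VectorField (M.T r)) : VectorField (M.T (r + 1)) where
  toHom := (D (M.κ (r + 1))).comp ((M.κ (r + 2)).comp ((D A.toHom).comp (M.κ (r + 1))))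
  proj_toHom := proj_lift (M.T r) (M.κ (r + 1)) (M.κ_comp_κ (r + 1)) A

/-- The iterated complete lifts of a vector field `X` on `TM`: `X^{c_0} = X` and
`X^{c_{i+1}} = (X^{c_i})^c`, a vector field on `T(T^i M) = T^{i+1} M`. -/
def iteratedLift (X : VectorField (M.T 1)) : (i : ℕ) → VectorField (M.T (i + 1))
  | 0 => X
  | i + 1 => completeLift (iteratedLift X i)

/-- `D²π_i ∘ A^c = A ∘ Dπ_i` for a vector field `A` on `T^{i+1} M`. -/
theorem DD_π_completeLift {i : ℕ} (A : VectorField (M.T (i + 1))) (ξ : M.T (i + 2)) :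
    D (D (M.π i)) ((completeLift A).toHom ξ) = A.toHom (D (M.π i) ξ) :=
  DD_proj_lift (M.T i) A ξ

/-- The local representation `(x, y, X, Y) ↦ (x, X)` of `Dπ : T(TN) → TN`. -/
def modelDproj (N : BanachManifold.{u}) : N.tangent.tangent.E →L[ℝ] N.tangent.E :=
  (ContinuousLinearMap.fst ℝ N.E N.E).prodMap (ContinuousLinearMap.fst ℝ N.E N.E)

theorem mem_source_tangent_tangent (N : BanachManifold.{u}) (v w : N.tangent.tangent) :
    w ∈ (extChartAt N.tangent.tangent.I v).source ↔ w.1.1 ∈ (extChartAt N.I v.1.1).source := by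
  simp only [extChartAt_source]
  rw [TangentBundle.mem_chart_source_iff, TangentBundle.mem_chart_source_iff]

theorem D_proj_mem_source (N : BanachManifold.{u}) (v w : N.tangent.tangent) :
    D N.proj w ∈ (extChartAt N.tangent.I (D N.proj v)).source ↔
      w ∈ (extChartAt N.tangent.tangent.I v).source := by
  rw [mem_source_tangent_tangent]
  simp only [extChartAt_source]
  rw [TangentBundle.mem_chart_source_iff]
  rfl

theorem extChartAt_D_proj (N : BanachManifold.{u}) (v w : N.tangent.tangent)
    (h : w ∈ (extChartAt N.tangent.tangent.I v).source) :
    extChartAt N.tangent.I (D N.proj v) (D N.proj w) =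
      modelDproj N (extChartAt N.tangent.tangent.I v w) := by
  rw [mem_source_tangent_tangent] at h
  rw [D_proj_eq]
  exact congrArg Prod.fst (extChartAt_flipRaw N.I v w h)

theorem mem_target_tangent (N : BanachManifold.{u}) (p : N.tangent) (e : N.tangent.E) :
    e ∈ (extChartAt N.tangent.I p).target ↔ e.1 ∈ (extChartAt N.I p.1).target := by
  constructor
  · intro he
    have h := (extChartAt N.tangent.I p).map_target he
    have h1 : (extChartAt N.I p.1).symm e.1 ∈ (extChartAt N.I p.1).source := by
      rw [extChartAt_source, TangentBundle.mem_chart_source_iff] at h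
      rw [extChartAt_source]
      exact h
    have h2 := (extChartAt N.I p.1).map_source h1
    have h3 : extChartAt N.I p.1 ((extChartAt N.I p.1).symm e.1) = e.1 :=
      congrArg Prod.fst ((extChartAt N.tangent.I p).right_inv he)
    rwa [h3] at h2
  · intro he
    rw [extChartAt_target, N.tangent.I.range_eq_univ, inter_univ, mem_preimage,
      TangentBundle.mem_chart_target_iff]
    rw [extChartAt_target, N.I.range_eq_univ, inter_univ, mem_preimage] at he
    exact he

theorem modelDproj_mem_target (N : BanachManifold.{u}) (v : N.tangent.tangent)
    (e : N.tangent.tangent.E) :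
    modelDproj N e ∈ (extChartAt N.tangent.I (D N.proj v)).target ↔
      e ∈ (extChartAt N.tangent.tangent.I v).target := by
  rw [mem_target_tangent, mem_target_tangent, mem_target_tangent]
  rfl

theorem D_proj_extChartAt_symm (N : BanachManifold.{u}) (v : N.tangent.tangent)
    (e : N.tangent.tangent.E) (h : e ∈ (extChartAt N.tangent.tangent.I v).target) :
    D N.proj ((extChartAt N.tangent.tangent.I v).symm e) =
      (extChartAt N.tangent.I (D N.proj v)).symm (modelDproj N e) := by
  have h1 := (extChartAt N.tangent.tangent.I v).map_target h
  have h2 := extChartAt_D_proj N v _ h1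
  rw [(extChartAt N.tangent.tangent.I v).right_inv h] at h2
  rw [← h2]
  exact ((extChartAt N.tangent.I (D N.proj v)).left_inv ((D_proj_mem_source N v _).2 h1)).symm

/-- The projective limit of a sequence of Banach manifolds, with the projective limit topology. -/
abbrev ProjLim (N : ℕ → BanachManifold.{u}) (f : ∀ i, Hom (N (i + 1)) (N i)) : Type u :=
  {x : ∀ i, N i // ∀ i, f i (x (i + 1)) = x i}

variable (M)

/-- `Dπ_r : T(T^{r+1} M) → T(T^r M)`. -/
def Dπ (r : ℕ) : Hom (M.T (r + 2)) (M.T (r + 1)) := D (M.π r)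

/-- `D²π_r : T²(T^{r+1} M) → T²(T^r M)`. -/
def DDπ (r : ℕ) : Hom (M.T (r + 3)) (M.T (r + 2)) := D (M.Dπ r)

/-- `T(T^∞M) = lim T(T^i M)`, with connecting maps `Dπ_i`. -/
abbrev TTInf : Type u := ProjLim (fun i => M.T (i + 1)) M.Dπ

/-- `T²(T^∞M) = lim T²(T^i M)`, with connecting maps `D²π_i`. -/
abbrev TTTInf : Type u := ProjLim (fun i => M.T (i + 2)) M.DDπ

/-- The model space of `T(T^∞M)`: the Fréchet space `lim E_{i+1}`, where `E_{i+1}` is the model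
space of `T(T^i M) = T^{i+1} M` and the connecting maps `(x, y, X, Y) ↦ (x, X)` represent
`Dπ_i`. -/
def modelInf : Submodule ℝ (∀ i, (M.T (i + 1)).E) where
  carrier := {e | ∀ i, modelDproj (M.T i) (e (i + 1)) = e i}
  add_mem' {a b} ha hb i := ((modelDproj (M.T i)).map_add (a (i + 1)) (b (i + 1))).trans
    (congrArg₂ _ (ha i) (hb i))
  zero_mem' i := (modelDproj (M.T i)).map_zero
  smul_mem' c a ha i := ((modelDproj (M.T i)).map_smul c (a (i + 1))).trans
    (congrArg (c • ·) (ha i))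

variable {M}

theorem TTInf.mem_source_iff (ξ η : M.TTInf) (i : ℕ) :
    η.1 i ∈ (extChartAt (M.T (i + 1)).I (ξ.1 i)).source ↔
      η.1 0 ∈ (extChartAt (M.T 1).I (ξ.1 0)).source := by
  induction i with
  | zero => rfl
  | succ i ih =>
    rw [← ih, ← ξ.2 i, ← η.2 i]
    exact (D_proj_mem_source (M.T i) (ξ.1 (i + 1)) (η.1 (i + 1))).symm

theorem TTInf.mem_target_iff (ξ : M.TTInf) (e : M.modelInf) (i : ℕ) :
    e.1 i ∈ (extChartAt (M.T (i + 1)).I (ξ.1 i)).target ↔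
      e.1 0 ∈ (extChartAt (M.T 1).I (ξ.1 0)).target := by
  induction i with
  | zero => rfl
  | succ i ih =>
    rw [← ih, ← ξ.2 i, ← e.2 i]
    exact (modelDproj_mem_target (M.T i) (ξ.1 (i + 1)) (e.1 (i + 1))).symm

open Classical in
/-- The chart of `T(T^∞M)` around `ξ`: the projective limit of the charts of the manifolds
`T(T^i M)` around the points `ξ_i` (all of them induced by one chart of `M`). -/
def TTInf.chart (ξ : M.TTInf) : OpenPartialHomeomorph M.TTInf M.modelInf where
  toFun η := if h : η.1 0 ∈ (extChartAt (M.T 1).I (ξ.1 0)).source then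
      ⟨fun i => extChartAt (M.T (i + 1)).I (ξ.1 i) (η.1 i), fun i => by
        have h1 := extChartAt_D_proj (M.T i) (ξ.1 (i + 1)) (η.1 (i + 1))
          ((mem_source_iff ξ η (i + 1)).2 h)
        rw [show D (M.T i).proj (ξ.1 (i + 1)) = ξ.1 i from ξ.2 i,
          show D (M.T i).proj (η.1 (i + 1)) = η.1 i from η.2 i] at h1
        exact h1.symm⟩
    else 0
  invFun e := if h : e.1 0 ∈ (extChartAt (M.T 1).I (ξ.1 0)).target then
      ⟨fun i => (extChartAt (M.T (i + 1)).I (ξ.1 i)).symm (e.1 i), fun i => by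
        have h1 := D_proj_extChartAt_symm (M.T i) (ξ.1 (i + 1)) (e.1 (i + 1))
          ((mem_target_iff ξ e (i + 1)).2 h)
        rw [show D (M.T i).proj (ξ.1 (i + 1)) = ξ.1 i from ξ.2 i,
          show modelDproj (M.T i) (e.1 (i + 1)) = e.1 i from e.2 i] at h1
        exact h1⟩
    else ξ
  source := {η | η.1 0 ∈ (extChartAt (M.T 1).I (ξ.1 0)).source}
  target := {e | e.1 0 ∈ (extChartAt (M.T 1).I (ξ.1 0)).target}
  map_source' η h := by
    rw [mem_ofPred_eq] at h
    rw [dif_pos h]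
    exact (extChartAt (M.T 1).I (ξ.1 0)).map_source h
  map_target' e h := by
    rw [mem_ofPred_eq] at h
    rw [dif_pos h]
    exact (extChartAt (M.T 1).I (ξ.1 0)).map_target h
  left_inv' η h := by
    rw [mem_ofPred_eq] at h
    have h' := (extChartAt (M.T 1).I (ξ.1 0)).map_source h
    rw [dif_pos h, dif_pos h']
    exact Subtype.ext (funext fun i => (extChartAt (M.T (i + 1)).I (ξ.1 i)).left_inv
      ((mem_source_iff ξ η i).2 h))
  right_inv' e h := by
    rw [mem_ofPred_eq] at h
    have h' := (extChartAt (M.T 1).I (ξ.1 0)).map_target h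
    rw [dif_pos h, dif_pos h']
    exact Subtype.ext (funext fun i => (extChartAt (M.T (i + 1)).I (ξ.1 i)).right_inv
      ((mem_target_iff ξ e i).2 h))
  open_source := (isOpen_extChartAt_source (I := (M.T 1).I) (ξ.1 0)).preimage
    ((continuous_apply 0).comp continuous_subtype_val)
  open_target := (isOpen_extChartAt_target (I := (M.T 1).I) (ξ.1 0)).preimage
    ((continuous_apply 0).comp continuous_subtype_val)
  continuousOn_toFun := by
    refine Topology.IsInducing.subtypeVal.continuousOn_iff.2 ?_
    have hc : ContinuousOn (fun η : M.TTInf => fun i =>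
        extChartAt (M.T (i + 1)).I (ξ.1 i) (η.1 i))
        {η | η.1 0 ∈ (extChartAt (M.T 1).I (ξ.1 0)).source} :=
      continuousOn_pi.2 fun i => (continuousOn_extChartAt (I := (M.T (i + 1)).I) (ξ.1 i)).comp
        ((continuous_apply i).comp continuous_subtype_val).continuousOn
        fun η h => (mem_source_iff ξ η i).2 h
    refine hc.congr fun η h => ?_
    rw [mem_ofPred_eq] at h
    rw [Function.comp_apply, dif_pos h]
  continuousOn_invFun := by
    refine Topology.IsInducing.subtypeVal.continuousOn_iff.2 ?_
    have hc : ContinuousOn (fun e : M.modelInf => fun i =>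
        (extChartAt (M.T (i + 1)).I (ξ.1 i)).symm (e.1 i))
        {e | e.1 0 ∈ (extChartAt (M.T 1).I (ξ.1 0)).target} :=
      continuousOn_pi.2 fun i => (continuousOn_extChartAt_symm (I := (M.T (i + 1)).I) (ξ.1 i)).comp
        ((continuous_apply i).comp continuous_subtype_val).continuousOn
        fun e h => (mem_target_iff ξ e i).2 h
    refine hc.congr fun e h => ?_
    rw [mem_ofPred_eq] at h
    rw [Function.comp_apply, dif_pos h]

/-- The Fréchet manifold structure of `T(T^∞M)`. -/
instance : ChartedSpace M.modelInf M.TTInf where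
  atlas := range TTInf.chart
  chartAt := TTInf.chart
  mem_chart_source ξ := mem_extChartAt_source (I := (M.T 1).I) (ξ.1 0)
  chart_mem_atlas ξ := mem_range_self ξ

/-- The limit `X^{c_∞} = lim X^{c_i} : T(T^∞M) → T²(T^∞M)` of the iterated complete lifts of a
vector field `X` on `TM`. -/
def liftInf (X : VectorField (M.T 1)) (ξ : M.TTInf) : M.TTTInf :=
  ⟨fun i => (iteratedLift X i).toHom (ξ.1 i), fun i =>
    (DD_π_completeLift (iteratedLift X i) (ξ.1 (i + 1))).trans (congrArg _ (ξ.2 i))⟩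

/-- The curve `γ` in the Fréchet manifold `T(T^∞M)` has velocity `η ∈ T²(T^∞M)` at time `t`: the
base point of `η` is `γ t`, and in the chart around `γ t` the difference quotients of `γ` at `t`
converge, in the Fréchet model space, to the coordinate of `η`. -/
def HasVelocityAt (γ : ℝ → M.TTInf) (η : M.TTTInf) (t : ℝ) : Prop :=
  (∀ i, M.π (i + 1) (η.1 i) = (γ t).1 i) ∧ ContinuousAt γ t ∧
    ∃ w : M.modelInf, (∀ i, w.1 i = coord (η.1 i)) ∧
      Tendsto (slope (fun s => chartAt M.modelInf (γ t) (γ s)) t) (𝓝[≠] t) (𝓝 w)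

/-- `γ`, restricted to the open interval `J ∋ 0`, is an integral curve starting at `ξ` of the vector
field `A : T(T^∞M) → T²(T^∞M)`. -/
structure IsIntegralCurveFromInf (A : M.TTInf → M.TTTInf) (ξ : M.TTInf) (γ : ℝ → M.TTInf)
    (J : Set ℝ) : Prop where
  isOpen : IsOpen J
  ordConnected : J.OrdConnected
  zero_mem : (0 : ℝ) ∈ J
  initial : γ 0 = ξ
  integral : ∀ t ∈ J, HasVelocityAt γ (A (γ t)) t

/-- A curve in `T(T^∞M) = lim T(T^i M)` is smooth if all its components are. -/
def SmoothOnInf (γ : ℝ → M.TTInf) (J : Set ℝ) : Prop :=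
  ∀ i, ContMDiffOn 𝓘(ℝ, ℝ) (M.T (i + 1)).I ∞ (fun t => (γ t).1 i) J

/-- A vector field on `T(T^∞M)` is complete if through every point there is an integral curve
defined on all of `ℝ`. -/
def IsCompleteInf (A : M.TTInf → M.TTTInf) : Prop :=
  ∀ ξ, ∃ γ : ℝ → M.TTInf, IsIntegralCurveFromInf A ξ γ univ

/-- `I(ξ)`, the set of `t` with `(ξ, t)` in the projective limit of the domains of the flows
`F^{c_i}` of the `X^{c_i}`. -/
def lifetimeInf (X : VectorField (M.T 1)) (ξ : M.TTInf) : Set ℝ :=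
  {t | ∀ i, t ∈ (iteratedLift X i).lifetime (ξ.1 i)}

end

end BanachManifold

/-! In a chart of the base, the vector field `κ ∘ DA` (`tangentLift`) is `(x, y) ↦ (φ x, Dφ x y)`
with `φ` the local form of `A`. Its integral curves over a given integral curve of `A` therefore
solve a linear equation, the variational equation `y' = Dφ(x(t)) y`, and linear equations lose no
lifetime (`exists_local_tangentLift`, `lifetime_subset_lifetime_tangentLift`). The complete lift
`A^c` is conjugate to `κ ∘ DA` by `κ_{r+1}`, and `Dπ_i = π_{i+1} ∘ κ_{i+2}`; hence every `X^{c_i}`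
lives at `ξ_i` at least as long as `X` at `ξ_0`, and `I(ξ)` is simply the lifetime of `ξ_0` under
`X` (`lifetimeInf_eq`). This makes an infinite intersection of open intervals open, and gives
completeness.

No differential equation is solved in the Fréchet space, where existence and uniqueness may fail. A
curve in the limit is an integral curve of `X^{c_∞}` exactly when each component is an integral
curve of `X^{c_i}` (`hasVelocityAt_liftInf_iff`). The relation `D²π_i ∘ X^{c_{i+1}} = X^{c_i} ∘
Dπ_i` makes the component flows compatible, so that they form a curve in the limit; smoothness and
uniqueness are inherited from the Banach level. -/

namespace BanachManifold

/-! ### Velocities in charts, uniqueness of integral curves, Hausdorff tangent bundles. -/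

variable {N N' : BanachManifold.{u}}

theorem VectorField.toHom_eq_mk (A : VectorField N) (x : N) :
    A.toHom x = Bundle.TotalSpace.mk x (A.field x) := by
  have h := A.proj_toHom x
  unfold VectorField.field coord
  generalize A.toHom x = v at *
  subst h
  rfl

theorem extChartAt_tangent (P v : N.tangent) :
    extChartAt N.tangent.I P v =
      (extChartAt N.I P.1 v.1, tangentCoordChange N.I v.1 P.1 v.1 v.2) := rfl

theorem mem_extChartAt_tangent_source (P v : N.tangent) :
    v ∈ (extChartAt N.tangent.I P).source ↔ v.1 ∈ (extChartAt N.I P.1).source := by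
  simp only [extChartAt_source]
  rw [TangentBundle.mem_chart_source_iff]

theorem hasFDerivAt_tangentCoordChange {x y z : N}
    (hx : z ∈ (extChartAt N.I x).source) (hy : z ∈ (extChartAt N.I y).source) :
    HasFDerivAt (extChartAt N.I y ∘ (extChartAt N.I x).symm) (tangentCoordChange N.I x y z)
      (extChartAt N.I x z) := by
  have h := hasFDerivWithinAt_tangentCoordChange (I := N.I) ⟨hx, hy⟩
  rwa [N.I.range_eq_univ, hasFDerivWithinAt_univ] at h

/-- The velocity of the curve `γ` at time `t` is the value of `A`. -/
def VectorField.IsTangentAt (A : VectorField N) (γ : ℝ → N) (t : ℝ) : Prop :=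
  HasMFDerivAt 𝓘(ℝ, ℝ) N.I γ t ((1 : ℝ →L[ℝ] ℝ).smulRight (A.field (γ t)))

theorem hasMFDerivAt_curve_iff {γ : ℝ → N} {t : ℝ} {v : N.E} :
    HasMFDerivAt 𝓘(ℝ, ℝ) N.I γ t ((1 : ℝ →L[ℝ] ℝ).smulRight v :) ↔
      ContinuousAt γ t ∧ HasDerivAt (extChartAt N.I (γ t) ∘ γ) v t := by
  rw [hasDerivAt_iff_hasFDerivAt, ← hasFDerivWithinAt_univ]
  refine and_congr Iff.rfl ?_
  simp only [mfld_simps]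
  rfl

theorem VectorField.isTangentAt_iff (A : VectorField N) {γ : ℝ → N} {t : ℝ} :
    A.IsTangentAt γ t ↔
      ContinuousAt γ t ∧ HasDerivAt (extChartAt N.I (γ t) ∘ γ) (coord (A.toHom (γ t))) t :=
  hasMFDerivAt_curve_iff

/-- Frees the velocity condition from the chart at the moving point `γ t`, so that a stretch of
curve can be treated in one chart. Velocities transform by the derivative of the chart change, and
the cocycle identity inverts this. Of `P` only the base point matters. -/
theorem VectorField.isTangentAt_iff_of_mem_source (A : VectorField N) (P : N.tangent) {γ : ℝ → N}
    {t : ℝ} (h : γ t ∈ (extChartAt N.I P.1).source) :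
    A.IsTangentAt γ t ↔ ContinuousAt γ t ∧
      HasDerivAt (extChartAt N.I P.1 ∘ γ) (extChartAt N.tangent.I P (A.toHom (γ t))).2 t := by
  rw [A.isTangentAt_iff]
  refine and_congr_right fun hc => ?_
  have hs : γ t ∈ (extChartAt N.I (γ t)).source := mem_extChartAt_source _
  have hv : (extChartAt N.tangent.I P (A.toHom (γ t))).2 =
      tangentCoordChange N.I (γ t) P.1 (γ t) (coord (A.toHom (γ t))) := by
    rw [extChartAt_tangent, A.toHom_eq_mk]
    rfl
  rw [hv]
  have key : ∀ x y : N, γ t ∈ (extChartAt N.I x).source → γ t ∈ (extChartAt N.I y).source →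
      ∀ w : N.E, HasDerivAt (extChartAt N.I x ∘ γ) w t →
        HasDerivAt (extChartAt N.I y ∘ γ) (tangentCoordChange N.I x y (γ t) w) t := by
    intro x y hx hy w hw
    refine ((hasFDerivAt_tangentCoordChange hx hy).comp_hasDerivAt t hw).congr_of_eventuallyEq ?_
    filter_upwards [hc.eventually (extChartAt_source_mem_nhds' (I := N.I) hx)] with s hs
    simp only [Function.comp_apply]
    rw [(extChartAt N.I x).left_inv hs]
  refine ⟨key _ _ hs h _, fun hd => ?_⟩
  have := key _ _ h hs _ hd
  rwa [tangentCoordChange_comp ⟨⟨hs, h⟩, hs⟩, tangentCoordChange_self hs] at this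

theorem VectorField.IsTangentAt.congr {A : VectorField N} {γ γ' : ℝ → N} {t : ℝ}
    (h : A.IsTangentAt γ t) (he : γ' =ᶠ[𝓝 t] γ) : A.IsTangentAt γ' t := by
  unfold IsTangentAt
  rw [he.eq_of_nhds]
  exact HasMFDerivAt.congr_of_eventuallyEq h he

theorem VectorField.isMIntegralCurveOn_iff (A : VectorField N) {γ : ℝ → N} {J : Set ℝ}
    (hJ : IsOpen J) : IsMIntegralCurveOn γ A.field J ↔ ∀ t ∈ J, A.IsTangentAt γ t :=
  ⟨fun h t ht => (h t ht).hasMFDerivAt (hJ.mem_nhds ht),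
    fun h t ht => (h t ht).hasMFDerivWithinAt⟩

/-- Related vector fields: `Df ∘ A = A' ∘ f` maps integral curves to integral curves. -/
theorem VectorField.IsTangentAt.map {A : VectorField N} {A' : VectorField N'} {f : Hom N N'}
    (hf : ∀ x, D f (A.toHom x) = A'.toHom (f x)) {γ : ℝ → N} {t : ℝ} (h : A.IsTangentAt γ t) :
    A'.IsTangentAt (f ∘ γ) t := by
  have hd : HasMFDerivAt N.I N'.I f (γ t) (mfderiv N.I N'.I f (γ t)) :=
    (f.contMDiff.mdifferentiable (by simp) (γ t)).hasMFDerivAt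
  have h1 := HasMFDerivAt.comp t hd h
  have h2 : mfderiv N.I N'.I f (γ t) (A.field (γ t)) = A'.field (f (γ t)) := by
    have h3 := hf (γ t)
    rw [A.toHom_eq_mk] at h3
    exact congrArg coord h3
  refine h1.congr_mfderiv ?_
  refine ContinuousLinearMap.ext fun a => ?_
  refine ((mfderiv N.I N'.I f (γ t)).map_smul (show ℝ from a) (A.field (γ t))).trans ?_
  rw [h2]
  rfl

theorem VectorField.contMDiff_field (A : VectorField N) :
    ContMDiff N.I N.I.tangent ∞ (fun x => (⟨x, A.field x⟩ : TangentBundle N.I N.carrier)) := by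
  have h := A.toHom.contMDiff
  rwa [show (A.toHom : N → N.tangent) = fun x => ⟨x, A.field x⟩ from
    funext A.toHom_eq_mk] at h

/-- Reduces uniqueness on an arbitrary, possibly unbounded, open interval to bounded intervals
containing the two times compared. -/
theorem exists_Ioo_subset {J : Set ℝ} (hJ : IsOpen J) (hc : J.OrdConnected) {s t : ℝ} (hs : s ∈ J)
    (ht : t ∈ J) : ∃ a b, s ∈ Ioo a b ∧ t ∈ Ioo a b ∧ Ioo a b ⊆ J := by
  have hm : min s t ∈ J := by rcases min_choice s t with h | h <;> rwa [h]
  have hM : max s t ∈ J := by rcases max_choice s t with h | h <;> rwa [h]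
  obtain ⟨a, ha, haJ⟩ := exists_Ioc_subset_of_mem_nhds (hJ.mem_nhds hm) (exists_lt _)
  obtain ⟨b, hb, hbJ⟩ := exists_Ico_subset_of_mem_nhds (hJ.mem_nhds hM) (exists_gt _)
  refine ⟨a, b, ⟨ha.trans_le (min_le_left _ _), (le_max_left _ _).trans_lt hb⟩,
    ⟨ha.trans_le (min_le_right _ _), (le_max_right _ _).trans_lt hb⟩, fun r hr => ?_⟩
  rcases le_total r (min s t) with h1 | h1
  · exact haJ ⟨hr.1, h1⟩
  rcases le_total r (max s t) with h2 | h2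
  · exact hc.out hm hM ⟨h1, h2⟩
  · exact hbJ ⟨h2, hr.2⟩

theorem VectorField.eqOn_of_isTangentAt [T2Space N] (A : VectorField N) {γ γ' : ℝ → N} {J : Set ℝ}
    (hJ : IsOpen J) (hc : J.OrdConnected) (h : ∀ t ∈ J, A.IsTangentAt γ t)
    (h' : ∀ t ∈ J, A.IsTangentAt γ' t) {s : ℝ} (hs : s ∈ J) (he : γ s = γ' s) :
    EqOn γ γ' J := by
  intro t ht
  obtain ⟨a, b, hsab, htab, hab⟩ := exists_Ioo_subset hJ hc hs ht
  have : BoundarylessManifold N.I N.carrier := inferInstance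
  exact isMIntegralCurveOn_Ioo_eqOn_of_contMDiff_boundaryless hsab
    (A.contMDiff_field.of_le (by norm_cast))
    ((A.isMIntegralCurveOn_iff isOpen_Ioo).2 fun r hr => h r (hab hr))
    ((A.isMIntegralCurveOn_iff isOpen_Ioo).2 fun r hr => h' r (hab hr)) he htab

/-- Two vectors over the same point lie in one chart and are separated in the model space; vectors
over different points are separated by their base points. -/
instance [T2Space N] : T2Space N.tangent := by
  refine ⟨fun v w hvw => ?_⟩
  by_cases h : v.1 = w.1
  · have hv : v ∈ (extChartAt N.tangent.I v).source := mem_extChartAt_source _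
    have hw : w ∈ (extChartAt N.tangent.I v).source := by
      rw [mem_extChartAt_tangent_source, ← h]
      exact mem_extChartAt_source _
    have hne : extChartAt N.tangent.I v v ≠ extChartAt N.tangent.I v w := fun he =>
      hvw ((extChartAt N.tangent.I v).injOn hv hw he)
    obtain ⟨U, V, hU, hV, hvU, hwV, hd⟩ := t2_separation hne
    refine ⟨(extChartAt N.tangent.I v).source ∩ extChartAt N.tangent.I v ⁻¹' U,
      (extChartAt N.tangent.I v).source ∩ extChartAt N.tangent.I v ⁻¹' V,
      (continuousOn_extChartAt v).isOpen_inter_preimage (isOpen_extChartAt_source v) hU,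
      (continuousOn_extChartAt v).isOpen_inter_preimage (isOpen_extChartAt_source v) hV,
      ⟨hv, hvU⟩, ⟨hw, hwV⟩, ?_⟩
    exact (hd.preimage _).mono inter_subset_right inter_subset_right
  · obtain ⟨U, V, hU, hV, hvU, hwV, hd⟩ := t2_separation h
    have hc : Continuous (N.proj : N.tangent → N) := N.proj.contMDiff.continuous
    exact ⟨_, _, hU.preimage hc, hV.preimage hc, hvU, hwV, hd.preimage _⟩

theorem T.t2Space (M : BanachManifold.{u}) [T2Space M] : ∀ r, T2Space (M.T r)
  | 0 => inferInstanceAs (T2Space M)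
  | r + 1 => haveI := T.t2Space M r; inferInstanceAs (T2Space (M.T r).tangent)

end BanachManifold

/-! ### Lifetimes, maximal integral curves, and smoothness of integral curves. -/

namespace BanachManifold

variable {N N' : BanachManifold.{u}}

namespace VectorField

theorem isIntegralCurveFrom_iff (A : VectorField N) {x : N} {γ : ℝ → N} {J : Set ℝ} :
    A.IsIntegralCurveFrom x γ J ↔ IsOpen J ∧ J.OrdConnected ∧ 0 ∈ J ∧ γ 0 = x ∧
      ∀ t ∈ J, A.IsTangentAt γ t :=
  ⟨fun h => ⟨h.1, h.2, h.3, h.4, (A.isMIntegralCurveOn_iff h.1).1 h.5⟩,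
    fun h => ⟨h.1, h.2.1, h.2.2.1, h.2.2.2.1, (A.isMIntegralCurveOn_iff h.1).2 h.2.2.2.2⟩⟩

theorem IsIntegralCurveFrom.isTangentAt {A : VectorField N} {x : N} {γ : ℝ → N} {J : Set ℝ}
    (h : A.IsIntegralCurveFrom x γ J) : ∀ t ∈ J, A.IsTangentAt γ t :=
  (A.isIntegralCurveFrom_iff.1 h).2.2.2.2

theorem IsIntegralCurveFrom.subset_lifetime {A : VectorField N} {x : N} {γ : ℝ → N} {J : Set ℝ}
    (h : A.IsIntegralCurveFrom x γ J) : J ⊆ A.lifetime x := fun _ ht => ⟨γ, J, h, ht⟩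

theorem IsIntegralCurveFrom.map {A : VectorField N} {A' : VectorField N'} {f : Hom N N'}
    (hf : ∀ x, D f (A.toHom x) = A'.toHom (f x)) {x : N} {γ : ℝ → N} {J : Set ℝ}
    (h : A.IsIntegralCurveFrom x γ J) : A'.IsIntegralCurveFrom (f x) (f ∘ γ) J :=
  A'.isIntegralCurveFrom_iff.2 ⟨h.isOpen, h.ordConnected, h.zero_mem, congrArg f h.initial,
    fun t ht => (h.isTangentAt t ht).map hf⟩

theorem lifetime_subset_lifetime_map {A : VectorField N} {A' : VectorField N'} {f : Hom N N'}
    (hf : ∀ x, D f (A.toHom x) = A'.toHom (f x)) (x : N) :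
    A.lifetime x ⊆ A'.lifetime (f x) :=
  fun _ ⟨_, _, h, ht⟩ => (h.map hf).subset_lifetime ht

theorem exists_isIntegralCurveFrom (A : VectorField N) (x : N) :
    ∃ (γ : ℝ → N) (J : Set ℝ), A.IsIntegralCurveFrom x γ J := by
  have : BoundarylessManifold N.I N.carrier := inferInstance
  obtain ⟨γ, h0, h⟩ := exists_isMIntegralCurveAt_of_contMDiffAt_boundaryless (I := N.I) 0
    ((A.contMDiff_field.of_le (by norm_cast)).contMDiffAt (x := x))
  obtain ⟨ε, hε, h⟩ := Metric.eventually_nhds_iff_ball.1 h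
  refine ⟨γ, Metric.ball 0 ε, A.isIntegralCurveFrom_iff.2 ⟨Metric.isOpen_ball,
    (convex_ball _ _).ordConnected, Metric.mem_ball_self hε, h0, h⟩⟩

theorem zero_mem_lifetime (A : VectorField N) (x : N) : 0 ∈ A.lifetime x := by
  obtain ⟨γ, J, h⟩ := A.exists_isIntegralCurveFrom x
  exact ⟨γ, J, h, h.zero_mem⟩

theorem isOpen_lifetime (A : VectorField N) (x : N) : IsOpen (A.lifetime x) :=
  isOpen_iff_mem_nhds.2 fun _ ⟨_, _, h, ht⟩ => mem_of_superset (h.isOpen.mem_nhds ht)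
    h.subset_lifetime

/-- The lifetime is a union of intervals that all contain `0`. -/
theorem ordConnected_lifetime (A : VectorField N) (x : N) : (A.lifetime x).OrdConnected := by
  refine (isPreconnected_of_forall 0 fun t ht => ?_).ordConnected
  obtain ⟨γ, J, h, ht⟩ := ht
  exact ⟨J, h.subset_lifetime, h.zero_mem, ht, h.ordConnected.isPreconnected⟩

variable [T2Space N]

theorem IsIntegralCurveFrom.eqOn {A : VectorField N} {x : N} {γ γ' : ℝ → N} {J J' : Set ℝ}
    (h : A.IsIntegralCurveFrom x γ J) (h' : A.IsIntegralCurveFrom x γ' J') :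
    EqOn γ γ' (J ∩ J') :=
  A.eqOn_of_isTangentAt (h.isOpen.inter h'.isOpen) (h.ordConnected.inter h'.ordConnected)
    (fun t ht => h.isTangentAt t ht.1) (fun t ht => h'.isTangentAt t ht.2)
    ⟨h.zero_mem, h'.zero_mem⟩ (h.initial.trans h'.initial.symm)

/-- The flow chooses a curve separately for each time; uniqueness makes these choices agree, so that
the flow is locally a single integral curve. -/
theorem IsIntegralCurveFrom.flow_eqOn {A : VectorField N} {x : N} {γ : ℝ → N} {J : Set ℝ}
    (h : A.IsIntegralCurveFrom x γ J) : EqOn (A.flow x) γ J := by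
  intro t ht
  have hl := h.subset_lifetime ht
  rw [flow, dif_pos hl]
  obtain ⟨J', h', ht'⟩ := hl.choose_spec
  exact h'.eqOn h ⟨ht', ht⟩

theorem isIntegralCurveFrom_flow (A : VectorField N) (x : N) :
    A.IsIntegralCurveFrom x (A.flow x) (A.lifetime x) := by
  refine A.isIntegralCurveFrom_iff.2 ⟨A.isOpen_lifetime x, A.ordConnected_lifetime x,
    A.zero_mem_lifetime x, ?_, ?_⟩
  · obtain ⟨γ, J, h⟩ := A.exists_isIntegralCurveFrom x
    exact (h.flow_eqOn h.zero_mem).trans h.initial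
  · rintro t ⟨γ, J, h, ht⟩
    exact (h.isTangentAt t ht).congr (h.flow_eqOn.eventuallyEq_of_mem (h.isOpen.mem_nhds ht))

/-- An integral curve through a point of a trajectory extends the trajectory. -/
theorem subset_lifetime_of_flow_eq (A : VectorField N) {x : N} {γ : ℝ → N} {K : Set ℝ}
    (hK : IsOpen K) (hc : K.OrdConnected) (h : ∀ t ∈ K, A.IsTangentAt γ t) {s : ℝ} (hs : s ∈ K)
    (hl : s ∈ A.lifetime x) (he : A.flow x s = γ s) : K ⊆ A.lifetime x := by
  classical
  have hf := A.isIntegralCurveFrom_flow x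
  have heq : EqOn (A.flow x) γ (A.lifetime x ∩ K) :=
    A.eqOn_of_isTangentAt (hf.isOpen.inter hK) (hf.ordConnected.inter hc)
      (fun t ht => hf.isTangentAt t ht.1) (fun t ht => h t ht.2) ⟨hl, hs⟩ he
  -- The overlap of the two domains is an interval containing `s`, so the curves agree there and can
  -- be glued.
  let δ : ℝ → N := fun t => if t ∈ A.lifetime x then A.flow x t else γ t
  have h1 : EqOn δ (A.flow x) (A.lifetime x) := fun t ht => if_pos ht
  have h2 : EqOn δ γ K := fun t ht => by
    by_cases htl : t ∈ A.lifetime x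
    · exact (h1 htl).trans (heq ⟨htl, ht⟩)
    · exact if_neg htl
  have hδ : A.IsIntegralCurveFrom x δ (A.lifetime x ∪ K) := by
    refine A.isIntegralCurveFrom_iff.2 ⟨hf.isOpen.union hK,
      (IsPreconnected.union s hl hs hf.ordConnected.isPreconnected
        hc.isPreconnected).ordConnected, .inl hf.zero_mem, (h1 hf.zero_mem).trans hf.initial, ?_⟩
    rintro t (ht | ht)
    · exact (hf.isTangentAt t ht).congr (h1.eventuallyEq_of_mem (hf.isOpen.mem_nhds ht))
    · exact (h t ht).congr (h2.eventuallyEq_of_mem (hK.mem_nhds ht))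
  exact subset_union_right.trans hδ.subset_lifetime

theorem isComplete_iff (A : VectorField N) : A.IsComplete ↔ ∀ x, A.lifetime x = univ :=
  ⟨fun h x => univ_subset_iff.1 (h x).choose_spec.subset_lifetime,
    fun h x => ⟨A.flow x, h x ▸ A.isIntegralCurveFrom_flow x⟩⟩

end VectorField

/-- The local representation of a vector field in the chart around `P.1`. -/
noncomputable def VectorField.localRep (A : VectorField N) (P : N.tangent) (e : N.E) : N.E :=
  (extChartAt N.tangent.I P (A.toHom ((extChartAt N.I P.1).symm e))).2

theorem VectorField.contDiffOn_localRep (A : VectorField N) (P : N.tangent) :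
    ContDiffOn ℝ ∞ (A.localRep P) (extChartAt N.I P.1).target := by
  have h1 : ContMDiffOn 𝓘(ℝ, N.E) N.I.tangent ∞ (A.toHom ∘ (extChartAt N.I P.1).symm)
      (extChartAt N.I P.1).target :=
    A.toHom.contMDiff.comp_contMDiffOn (contMDiffOn_extChartAt_symm P.1)
  have h2 : ContMDiffOn 𝓘(ℝ, N.E) 𝓘(ℝ, N.E × N.E) ∞
      (extChartAt N.tangent.I P ∘ A.toHom ∘ (extChartAt N.I P.1).symm)
      (extChartAt N.I P.1).target := by
    refine (contMDiffOn_extChartAt (I := N.tangent.I) (x := P)).comp h1 fun e he => ?_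
    rw [mem_preimage, ← extChartAt_source N.tangent.I, mem_extChartAt_tangent_source,
      Function.comp_apply, A.toHom_eq_mk]
    exact (extChartAt N.I P.1).map_target he
  exact h2.contDiffOn.snd

theorem VectorField.isTangentAt_iff_localRep (A : VectorField N) (P : N.tangent) {γ : ℝ → N}
    {t : ℝ} (h : γ t ∈ (extChartAt N.I P.1).source) :
    A.IsTangentAt γ t ↔ ContinuousAt γ t ∧
      HasDerivAt (extChartAt N.I P.1 ∘ γ) (A.localRep P (extChartAt N.I P.1 (γ t))) t := by
  rw [A.isTangentAt_iff_of_mem_source P h, localRep, (extChartAt N.I P.1).left_inv h]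

theorem VectorField.IsTangentAt.continuousAt {A : VectorField N} {γ : ℝ → N} {t : ℝ}
    (h : A.IsTangentAt γ t) : ContinuousAt γ t := HasMFDerivAt.continuousAt h

/-- Integral curves of smooth vector fields are smooth. -/
theorem VectorField.contMDiffAt_of_isTangentAt (A : VectorField N) {γ : ℝ → N} {t : ℝ}
    (h : ∀ᶠ s in 𝓝 t, A.IsTangentAt γ s) : ContMDiffAt 𝓘(ℝ, ℝ) N.I ∞ γ t := by
  let P : N.tangent := A.toHom (γ t)
  have hP : P.1 = γ t := A.proj_toHom _
  have hcont : ContinuousAt γ t := h.self_of_nhds.continuousAt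
  have hsrc : ∀ᶠ s in 𝓝 t, γ s ∈ (extChartAt N.I P.1).source :=
    hcont.eventually (hP ▸ extChartAt_source_mem_nhds _)
  obtain ⟨ε, hε, hball⟩ := Metric.nhds_basis_closedBall.eventually_iff.1 (h.and hsrc)
  rw [Real.closedBall_eq_Icc] at hball
  -- In one chart the curve solves an autonomous equation with smooth right-hand side, and
  -- smoothness follows by bootstrapping.
  have hsm : ContDiffOn ℝ ∞ (extChartAt N.I P.1 ∘ γ) (Icc (t - ε) (t + ε)) := by
    refine ODE.contDiffOn_enat_Icc_of_hasDerivWithinAt (n := ⊤) (u := (extChartAt N.I P.1).target)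
      (f := fun _ => A.localRep P) ?_ (fun s hs => ?_) (fun s hs => ?_)
    · exact (A.contDiffOn_localRep P).comp contDiffOn_snd fun e he => he.2
    · exact ((A.isTangentAt_iff_localRep P (hball hs).2).1 (hball hs).1).2.hasDerivWithinAt
    · exact (extChartAt N.I P.1).map_source (hball hs).2
  have hsm' : ContMDiffAt 𝓘(ℝ, ℝ) 𝓘(ℝ, N.E) ∞ (extChartAt N.I P.1 ∘ γ) t :=
    (hsm.contDiffAt (Icc_mem_nhds (by linarith) (by linarith))).contMDiffAt
  have hs := hsrc.self_of_nhds
  have hsymm : ContMDiffAt 𝓘(ℝ, N.E) N.I ∞ (extChartAt N.I P.1).symm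
      ((extChartAt N.I P.1 ∘ γ) t) :=
    (contMDiffOn_extChartAt_symm P.1).contMDiffAt
      ((isOpen_extChartAt_target P.1).mem_nhds ((extChartAt N.I P.1).map_source hs))
  refine (hsymm.comp t hsm').congr_of_eventuallyEq ?_
  filter_upwards [hsrc] with s hs
  exact ((extChartAt N.I P.1).left_inv hs).symm

end BanachManifold

/-! ### The variational equation: lifts of integral curves to the tangent bundle. -/

/-- For a linear equation both the Lipschitz constant and the growth rate are governed by `C`, so
the existence time depends neither on the initial value `y₀` nor on the initial time `s`. -/
theorem exists_hasDerivWithinAt_linear {F : Type*} [NormedAddCommGroup F] [NormedSpace ℝ F]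
    [CompleteSpace F] {L : ℝ → F →L[ℝ] F} {t₀ ε C : ℝ}
    (hL : ContinuousOn L (Icc (t₀ - ε) (t₀ + ε))) (hC : ∀ t ∈ Icc (t₀ - ε) (t₀ + ε), ‖L t‖ ≤ C)
    (hCε : 4 * C * ε ≤ 1) {s : ℝ} (hs : s ∈ Icc (t₀ - ε) (t₀ + ε)) (y₀ : F) :
    ∃ y : ℝ → F, y s = y₀ ∧ ∀ t ∈ Icc (t₀ - ε) (t₀ + ε),
      HasDerivWithinAt y (L t (y t)) (Icc (t₀ - ε) (t₀ + ε)) t := by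
  have hC0 : 0 ≤ C := (norm_nonneg _).trans (hC s hs)
  have hy := norm_nonneg y₀
  lift C to NNReal using hC0
  have hε : 0 ≤ ε := by linarith [hs.1, hs.2]
  -- On the ball of radius `‖y₀‖ + 1` about `y₀` the speed is at most `C (2‖y₀‖ + 1)`. As `s` may be
  -- anywhere in the interval, the elapsed time is at most `2ε`, and `4Cε ≤ 1` keeps the
  -- displacement below `‖y₀‖ + 1/2`.
  have hp : IsPicardLindelof (fun t y => L t y) (⟨s, hs⟩ : Icc (t₀ - ε) (t₀ + ε)) y₀ (‖y₀‖₊ + 1) 0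
      (C * (2 * ‖y₀‖₊ + 1)) C := by
    refine ⟨fun t ht => ?_, fun x _ => hL.clm_apply continuousOn_const, fun t ht x hx => ?_, ?_⟩
    · exact ((L t).lipschitz.weaken (hC t ht)).lipschitzOnWith
    · have h1 : ‖x‖ ≤ 2 * ‖y₀‖ + 1 := by
        have h2 := norm_le_norm_add_norm_sub y₀ x
        have h3 := mem_closedBall_iff_norm.1 hx
        push_cast [coe_nnnorm] at h3
        rw [norm_sub_rev] at h2
        linarith
      push_cast [coe_nnnorm]
      exact ((L t).le_opNorm x).trans (mul_le_mul (hC t ht) h1 (norm_nonneg _) C.2)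
    · push_cast [coe_nnnorm]
      have h1 : max (t₀ + ε - s) (s - (t₀ - ε)) ≤ 2 * ε :=
        max_le (by linarith [hs.1]) (by linarith [hs.2])
      calc (C : ℝ) * (2 * ‖y₀‖ + 1) * max (t₀ + ε - s) (s - (t₀ - ε))
          ≤ C * (2 * ‖y₀‖ + 1) * (2 * ε) := by gcongr
        _ = (4 * C * ε) * (‖y₀‖ + 1 / 2) := by ring
        _ ≤ 1 * (‖y₀‖ + 1 / 2) := by gcongr
        _ ≤ ‖y₀‖ + 1 - 0 := by linarith
  exact hp.exists_eq_forall_mem_Icc_hasDerivWithinAt₀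

namespace BanachManifold

variable {N N' : BanachManifold.{u}}

/-- Transports solutions found in the model space back to the manifold. -/
theorem VectorField.isTangentAt_symm_comp (A : VectorField N) (P : N.tangent) {c : ℝ → N.E} {t : ℝ}
    (hmem : c t ∈ (extChartAt N.I P.1).target) (hd : HasDerivAt c (A.localRep P (c t)) t) :
    A.IsTangentAt ((extChartAt N.I P.1).symm ∘ c) t := by
  have hc := hd.continuousAt
  rw [A.isTangentAt_iff_localRep P ((extChartAt N.I P.1).map_target hmem)]
  refine ⟨(continuousAt_extChartAt_symm'' hmem).comp hc, ?_⟩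
  rw [Function.comp_apply, (extChartAt N.I P.1).right_inv hmem]
  refine hd.congr_of_eventuallyEq ?_
  filter_upwards [hc.eventually ((isOpen_extChartAt_target P.1).mem_nhds hmem)] with s hs
  exact (extChartAt N.I P.1).right_inv hs

/-- The local representation of a smooth map in the charts around `p` and `q`. -/
noncomputable def mapRep (f : Hom N N') (p : N) (q : N') (e : N.E) : N'.E :=
  extChartAt N'.I q (f ((extChartAt N.I p).symm e))

theorem differentiableAt_mapRep (f : Hom N N') (p : N) (q : N') {x : N}
    (hx : x ∈ (extChartAt N.I p).source) (hf : f x ∈ (extChartAt N'.I q).source) :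
    DifferentiableAt ℝ (mapRep f p q) (extChartAt N.I p x) := by
  have h1 : ContMDiffAt 𝓘(ℝ, N.E) N.I ∞ (extChartAt N.I p).symm (extChartAt N.I p x) :=
    (contMDiffOn_extChartAt_symm p).contMDiffAt
      ((isOpen_extChartAt_target p).mem_nhds ((extChartAt N.I p).map_source hx))
  have h2 : ContMDiffAt N'.I 𝓘(ℝ, N'.E) ∞ (extChartAt N'.I q)
      (f ((extChartAt N.I p).symm (extChartAt N.I p x))) := by
    rw [(extChartAt N.I p).left_inv hx]
    exact contMDiffAt_extChartAt' (by rwa [extChartAt_source] at hf)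
  have h3 : ContMDiffAt 𝓘(ℝ, N.E) 𝓘(ℝ, N'.E) ∞ (mapRep f p q) (extChartAt N.I p x) :=
    h2.comp (extChartAt N.I p x) (f.contMDiff.contMDiffAt.comp (extChartAt N.I p x) h1)
  exact h3.contDiffAt.differentiableAt (by simp)

/-- The local representation of the tangent map. -/
theorem extChartAt_D (f : Hom N N') (P : N.tangent) (Q : N'.tangent) {v : N.tangent}
    (hv : v.1 ∈ (extChartAt N.I P.1).source) (hf : f v.1 ∈ (extChartAt N'.I Q.1).source) :
    extChartAt N'.tangent.I Q (D f v) =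
      (mapRep f P.1 Q.1 (extChartAt N.tangent.I P v).1,
        fderiv ℝ (mapRep f P.1 Q.1) (extChartAt N.tangent.I P v).1
          (extChartAt N.tangent.I P v).2) := by
  obtain ⟨x, w⟩ := v
  have hx : x ∈ (extChartAt N.I x).source := mem_extChartAt_source _
  have hfx : f x ∈ (extChartAt N'.I (f x)).source := mem_extChartAt_source _
  have hd : MDifferentiableAt N.I N'.I f x := f.contMDiff.mdifferentiable (by simp) x
  have h1 : HasFDerivAt (mapRep f x (f x)) (mfderiv N.I N'.I f x : N.E →L[ℝ] N'.E)
      (extChartAt N.I x x) := by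
    have := hd.hasMFDerivAt.2
    rw [N.I.range_eq_univ] at this
    exact hasFDerivWithinAt_univ.1 this
  have hpt : mapRep f x (f x) (extChartAt N.I x x) = extChartAt N'.I (f x) (f x) := by
    rw [mapRep, (extChartAt N.I x).left_inv hx]
  have h2 := (hpt ▸ hasFDerivAt_tangentCoordChange hfx hf).comp _ h1
  have h3 := ((differentiableAt_mapRep f P.1 Q.1 hv hf).hasFDerivAt)
  have hpt' : (extChartAt N.I P.1 ∘ (extChartAt N.I x).symm) (extChartAt N.I x x) =
      extChartAt N.I P.1 x := by
    rw [Function.comp_apply, (extChartAt N.I x).left_inv hx]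
  have h4 : HasFDerivAt (mapRep f P.1 Q.1 ∘ (extChartAt N.I P.1 ∘ (extChartAt N.I x).symm))
      ((fderiv ℝ (mapRep f P.1 Q.1) (extChartAt N.I P.1 x)).comp (tangentCoordChange N.I x P.1 x))
      (extChartAt N.I x x) :=
    HasFDerivAt.comp _ (by rw [hpt']; exact h3) (hasFDerivAt_tangentCoordChange hx hv)
  have hmem : ∀ᶠ e in 𝓝 (extChartAt N.I x x), (extChartAt N.I x).symm e ∈
      (extChartAt N.I P.1).source ∩ f ⁻¹' (extChartAt N'.I (f x)).source := by
    have h5 := (continuousAt_extChartAt_symm (I := N.I) x)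
    refine h5.eventually ?_
    rw [(extChartAt N.I x).left_inv hx]
    exact inter_mem (extChartAt_source_mem_nhds' hv)
      (f.contMDiff.continuous.continuousAt (extChartAt_source_mem_nhds (f x)))
  -- Both composites are `f` read from the chart at `x` to the chart at `Q.1`, so the two chain
  -- rules give the same derivative.
  have heq : (extChartAt N'.I Q.1 ∘ (extChartAt N'.I (f x)).symm) ∘ mapRep f x (f x)
      =ᶠ[𝓝 (extChartAt N.I x x)]
        mapRep f P.1 Q.1 ∘ (extChartAt N.I P.1 ∘ (extChartAt N.I x).symm) := by
    filter_upwards [hmem] with e he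
    simp only [Function.comp_apply, mapRep]
    rw [(extChartAt N.I P.1).left_inv he.1, (extChartAt N'.I (f x)).left_inv he.2]
  have h6 := h2.unique (h4.congr_of_eventuallyEq heq)
  have h7 := DFunLike.congr_fun h6 w
  refine Prod.ext ?_ ?_
  · change extChartAt N'.I Q.1 (f x) = mapRep f P.1 Q.1 (extChartAt N.I P.1 x)
    rw [mapRep, (extChartAt N.I P.1).left_inv hv]
  · exact h7

namespace VectorField

/-- The vector field `κ ∘ DA` on `TN`, for a vector field `A` on `N`. -/
noncomputable def tangentLift (A : VectorField N) : VectorField N.tangent where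
  toHom := N.flip.comp (D A.toHom)
  proj_toHom v := by
    have h2 : N.proj.comp A.toHom = ContMDiffMap.id := by
      ext x : 1
      exact A.proj_toHom x
    calc N.tangent.proj (N.flip (D A.toHom v)) = D N.proj (D A.toHom v) := by rw [D_proj_eq]; rfl
      _ = ((D N.proj).comp (D A.toHom)) v := rfl
      _ = v := by rw [← D_comp, h2, D_id]; rfl

/-- By `Dπ = π ∘ κ` and `κ² = id`, only the base point of `DA(v)` remains. Consequently integral
curves of the lift project to integral curves of `A`. -/
theorem D_proj_tangentLift (A : VectorField N) (v : N.tangent) :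
    D N.proj (A.tangentLift.toHom v) = A.toHom (N.proj v) := by
  rw [D_proj_eq]; rfl

/-- In charts the lift of `φ` is `(x, y) ↦ (φ x, Dφ x y)`. -/
theorem localRep_tangentLift (A : VectorField N) (R : N.tangent.tangent) {e : N.tangent.E}
    (he : e ∈ (extChartAt N.tangent.I R.1).target) :
    A.tangentLift.localRep R e = (A.localRep R.1 e.1, fderiv ℝ (A.localRep R.1) e.1 e.2) := by
  set P : N.tangent := R.1 with hP
  set v : N.tangent := (extChartAt N.tangent.I P).symm e with hv
  have hvs : v.1 ∈ (extChartAt N.I P.1).source :=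
    (mem_extChartAt_tangent_source P v).1 ((extChartAt N.tangent.I P).map_target he)
  have hev : extChartAt N.tangent.I P v = e := (extChartAt N.tangent.I P).right_inv he
  have hAv : (A.toHom v.1).1 = v.1 := A.proj_toHom _
  -- Centring the chart at the flip of `R` makes the flipped chart that of `R` itself, since the
  -- flip is an involution.
  have h1 := extChartAt_flipRaw N.I (flipRaw N.I R) (D A.toHom v) (by
    change (A.toHom v.1).1 ∈ (extChartAt N.I P.1).source
    rwa [hAv])
  have h2 := extChartAt_D A.toHom P (flipRaw N.I R) hvs (by
    rw [mem_extChartAt_tangent_source, hAv]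
    exact hvs)
  rw [hev] at h2
  have he1 : e.1 ∈ (extChartAt N.I P.1).target := (mem_target_tangent N P e).1 he
  -- `(flipRaw N.I R).1` and `P` lie over the same point, so they induce the same chart, in which
  -- the section `A` is a graph.
  have hrep : ∀ a ∈ (extChartAt N.I P.1).target,
      mapRep A.toHom P.1 (flipRaw N.I R).1 a = (a, A.localRep P a) := by
    intro a ha
    refine Prod.ext ?_ rfl
    change extChartAt N.I P.1 (A.toHom ((extChartAt N.I P.1).symm a)).1 = a
    rw [show (A.toHom ((extChartAt N.I P.1).symm a)).1 = _ from A.proj_toHom _]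
    exact (extChartAt N.I P.1).right_inv ha
  have hd : HasFDerivAt (A.localRep P) (fderiv ℝ (A.localRep P) e.1) e.1 :=
    (((A.contDiffOn_localRep P).contDiffAt
      ((isOpen_extChartAt_target P.1).mem_nhds he1)).differentiableAt (by simp)).hasFDerivAt
  have hd2 : HasFDerivAt (mapRep A.toHom P.1 (flipRaw N.I R).1)
      ((ContinuousLinearMap.id ℝ N.E).prod (fderiv ℝ (A.localRep P) e.1)) e.1 :=
    ((hasFDerivAt_id e.1).prodMk hd).congr_of_eventuallyEq
      (eventually_of_mem ((isOpen_extChartAt_target P.1).mem_nhds he1) hrep)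
  rw [hrep _ he1, hd2.fderiv] at h2
  have h3 := h1.trans (congrArg swapRaw h2)
  exact congrArg Prod.snd h3

/-- Near a point of an integral curve of `A`, all tangent vectors along the curve are transported by
`A.tangentLift` for a uniform time. -/
theorem exists_local_tangentLift (A : VectorField N) {γ : ℝ → N} {t₀ : ℝ}
    (h : ∀ᶠ t in 𝓝 t₀, A.IsTangentAt γ t) :
    ∃ ε > 0, ∀ s ∈ Metric.ball t₀ ε, ∀ w : N.tangent, w.1 = γ s → ∃ Λ : ℝ → N.tangent,
      Λ s = w ∧ ∀ t ∈ Metric.ball t₀ ε, A.tangentLift.IsTangentAt Λ t := by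
  -- Only the point `γ t₀` under `R` is used, to select the chart; the zero vectors are arbitrary.
  let R : N.tangent.tangent := ⟨⟨γ t₀, (0 : N.E)⟩, (0 : N.E × N.E)⟩
  have hsrc : ∀ᶠ t in 𝓝 t₀, γ t ∈ (extChartAt N.I R.1.1).source :=
    h.self_of_nhds.continuousAt.eventually (extChartAt_source_mem_nhds (γ t₀))
  obtain ⟨ε₀, hε₀, hball⟩ := Metric.nhds_basis_closedBall.eventually_iff.1 (h.and hsrc)
  rw [Real.closedBall_eq_Icc] at hball
  set c : ℝ → N.E := extChartAt N.I R.1.1 ∘ γ with hc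
  have hct : ∀ t ∈ Icc (t₀ - ε₀) (t₀ + ε₀), c t ∈ (extChartAt N.I R.1.1).target :=
    fun t ht => (extChartAt N.I R.1.1).map_source (hball ht).2
  have hcd : ∀ t ∈ Icc (t₀ - ε₀) (t₀ + ε₀), HasDerivAt c (A.localRep R.1 (c t)) t :=
    fun t ht => ((A.isTangentAt_iff_localRep R.1 (hball ht).2).1 (hball ht).1).2
  set L : ℝ → N.E →L[ℝ] N.E := fun t => fderiv ℝ (A.localRep R.1) (c t) with hLdef
  have hL : ContinuousOn L (Icc (t₀ - ε₀) (t₀ + ε₀)) :=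
    ((A.contDiffOn_localRep R.1).continuousOn_fderiv_of_isOpen
      (isOpen_extChartAt_target (I := N.I) R.1.1) (by simp)).comp
      (fun t ht => (hcd t ht).continuousAt.continuousWithinAt) hct
  obtain ⟨C, hC⟩ := isCompact_Icc.exists_bound_of_continuousOn hL
  have hC0 : 0 ≤ C := (norm_nonneg _).trans (hC t₀ ⟨by linarith, by linarith⟩)
  -- The second term gives `4Cε ≤ 1`, with `C + 1` guarding against `C = 0`. It is fixed before `s`
  -- and `w` are chosen.
  set ε := min ε₀ (1 / (4 * (C + 1))) with hε
  have hεpos : 0 < ε := lt_min hε₀ (by positivity)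
  have hCε : 4 * C * ε ≤ 1 := by
    calc 4 * C * ε ≤ 4 * (C + 1) * (1 / (4 * (C + 1))) := by
          gcongr
          · linarith
          · exact min_le_right _ _
      _ = 1 := by field_simp
  have hsub : Icc (t₀ - ε) (t₀ + ε) ⊆ Icc (t₀ - ε₀) (t₀ + ε₀) :=
    Icc_subset_Icc (by linarith [min_le_left ε₀ (1 / (4 * (C + 1)))])
      (by linarith [min_le_left ε₀ (1 / (4 * (C + 1)))])
  refine ⟨ε, hεpos, fun s hs w hw => ?_⟩
  rw [Real.ball_eq_Ioo] at hs ⊢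
  -- The base component is the given curve `c`; only the fibre component `y' = Dφ(c(t)) y` has to be
  -- solved.
  obtain ⟨y, hys, hy⟩ := exists_hasDerivWithinAt_linear (hL.mono hsub)
    (fun t ht => hC t (hsub ht)) hCε (Ioo_subset_Icc_self hs) (extChartAt N.tangent.I R.1 w).2
  refine ⟨(extChartAt N.tangent.I R.1).symm ∘ fun t => (c t, y t), ?_, fun t ht => ?_⟩
  · have h1 : (c s, y s) = extChartAt N.tangent.I R.1 w := by
      rw [hys]
      refine Prod.ext ?_ rfl
      change extChartAt N.I R.1.1 (γ s) = extChartAt N.I R.1.1 w.1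
      rw [hw]
    rw [Function.comp_apply, h1]
    refine (extChartAt N.tangent.I R.1).left_inv ((mem_extChartAt_tangent_source _ _).2 ?_)
    rw [hw]
    exact (hball (hsub (Ioo_subset_Icc_self hs))).2
  · have ht' := Ioo_subset_Icc_self ht
    have hmem : ((c t, y t) : N.tangent.E) ∈ (extChartAt N.tangent.I R.1).target :=
      (mem_target_tangent N R.1 _).2 (hct t (hsub ht'))
    refine A.tangentLift.isTangentAt_symm_comp R hmem ?_
    rw [A.localRep_tangentLift R hmem]
    exact (hcd t (hsub ht')).prodMk ((hy t ht').hasDerivAt (Icc_mem_nhds ht.1 ht.2))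

/-- Integral curves of `A` lift to `A.tangentLift` without loss of lifetime. -/
theorem lifetime_subset_lifetime_tangentLift [T2Space N] (A : VectorField N) (v : N.tangent) :
    A.lifetime (N.proj v) ⊆ A.tangentLift.lifetime v := by
  have hA := A.isIntegralCurveFrom_flow (N.proj v)
  have hB := A.tangentLift.isIntegralCurveFrom_flow v
  have hproj := (hB.map (f := N.proj) A.D_proj_tangentLift).flow_eqOn
  -- Connectedness argument: the lifetime of the lift is open, and it is relatively closed in that
  -- of `A`. At a limit time `t₀`, the uniform `ε` is available before a time `s` near `t₀` is
  -- picked, so the local lift through the trajectory at time `s` passes beyond `t₀`.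
  refine hA.ordConnected.isPreconnected.subset_of_closure_inter_subset hB.isOpen
    ⟨0, hA.zero_mem, hB.zero_mem⟩ fun t₀ ⟨hcl, ht₀⟩ => ?_
  obtain ⟨ε, hε, hlift⟩ := A.exists_local_tangentLift
    (eventually_of_mem (hA.isOpen.mem_nhds ht₀) hA.isTangentAt)
  obtain ⟨s, hs, hsl⟩ := mem_closure_iff.1 hcl _ Metric.isOpen_ball (Metric.mem_ball_self hε)
  obtain ⟨Λ, hΛs, hΛ⟩ := hlift s hs (A.tangentLift.flow v s) (hproj hsl).symm
  exact A.tangentLift.subset_lifetime_of_flow_eq Metric.isOpen_ball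
    (convex_ball _ _).ordConnected hΛ hs hsl hΛs.symm (Metric.mem_ball_self hε)

end VectorField

end BanachManifold

/-! ### Iterated complete lifts and passage to the projective limit. -/

namespace BanachManifold

variable {M : BanachManifold.{u}}

/-- As `κ_{r+1}` is an involution, the definition of `A^c` is a conjugation of `κ_{r+2} ∘ DA`, so
`κ_{r+1}` carries integral curves of one to those of the other. -/
theorem D_κ_tangentLift {r : ℕ} (A : VectorField (M.T r)) (v : M.T (r + 1)) :
    D (M.κ (r + 1)) (A.tangentLift.toHom v) = (completeLift A).toHom (M.κ (r + 1) v) := by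
  have h : M.κ (r + 1) (M.κ (r + 1) v) = v := DFunLike.congr_fun (M.κ_comp_κ (r + 1)) v
  change _ = D (M.κ (r + 1)) (M.κ (r + 2) (D A.toHom (M.κ (r + 1) (M.κ (r + 1) v))))
  rw [h]
  rfl

theorem lifetime_subset_lifetime_completeLift [T2Space M] {r : ℕ} (A : VectorField (M.T r))
    (ξ : M.T (r + 1)) :
    A.lifetime (M.π r (M.κ (r + 1) ξ)) ⊆ (completeLift A).lifetime ξ := by
  have := T.t2Space M r
  have h : M.κ (r + 1) (M.κ (r + 1) ξ) = ξ := DFunLike.congr_fun (M.κ_comp_κ (r + 1)) ξ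
  have h1 := A.lifetime_subset_lifetime_tangentLift (M.κ (r + 1) ξ)
  have h2 := VectorField.lifetime_subset_lifetime_map (A := A.tangentLift) (A' := completeLift A)
    (f := M.κ (r + 1)) (D_κ_tangentLift A) (M.κ (r + 1) ξ)
  exact h1.trans (h2.trans_eq (congrArg (completeLift A).lifetime h))

theorem IsComplete.completeLift [T2Space M] {r : ℕ} {A : VectorField (M.T r)}
    (hA : A.IsComplete) : (completeLift A).IsComplete := by
  have := T.t2Space M r
  have := T.t2Space M (r + 1)
  rw [VectorField.isComplete_iff] at hA ⊢
  exact fun ξ => univ_subset_iff.1 (hA _ ▸ lifetime_subset_lifetime_completeLift A ξ)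

theorem lifetime_iteratedLift [T2Space M] (X : VectorField (M.T 1)) (ξ : M.TTInf) (i : ℕ) :
    X.lifetime (ξ.1 0) ⊆ (iteratedLift X i).lifetime (ξ.1 i) := by
  induction i with
  | zero => exact Subset.rfl
  | succ i ih =>
    refine ih.trans ?_
    have h := lifetime_subset_lifetime_completeLift (iteratedLift X i) (ξ.1 (i + 1))
    -- The conjugation by `κ` shifts the base point from `π ξ_{i+1}` to `Dπ_i ξ_{i+1}`, which is the
    -- preceding component of the thread.
    have h1 : M.π (i + 1) (M.κ (i + 2) (ξ.1 (i + 1))) = ξ.1 i :=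
      (DFunLike.congr_fun (M.D_π i) (ξ.1 (i + 1))).symm.trans (ξ.2 i)
    rwa [h1] at h

/-- The lifetimes do not shrink with `i`, so their intersection is the term `i = 0`; in particular
it is open. -/
theorem lifetimeInf_eq [T2Space M] (X : VectorField (M.T 1)) (ξ : M.TTInf) :
    lifetimeInf X ξ = X.lifetime (ξ.1 0) :=
  Subset.antisymm (fun _ ht => ht 0) fun _ ht i => lifetime_iteratedLift X ξ i ht

theorem chartAt_apply {ξ η : M.TTInf} (h : η.1 0 ∈ (extChartAt (M.T 1).I (ξ.1 0)).source) (i : ℕ) :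
    (chartAt M.modelInf ξ η).1 i = extChartAt (M.T (i + 1)).I (ξ.1 i) (η.1 i) := by
  change ((TTInf.chart ξ) η).1 i = _
  have : (TTInf.chart ξ) η = _ := dif_pos h
  rw [this]

/-- An integral curve of the limit field is a sequence of integral curves of the components. -/
theorem hasVelocityAt_liftInf_iff (X : VectorField (M.T 1)) {γ : ℝ → M.TTInf} {t : ℝ} :
    HasVelocityAt γ (liftInf X (γ t)) t ↔
      ∀ i, (iteratedLift X i).IsTangentAt (fun s => (γ s).1 i) t := by
  have hcont : ContinuousAt γ t ↔ ∀ i, ContinuousAt (fun s => (γ s).1 i) t :=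
    (Topology.IsInducing.subtypeVal.continuousAt_iff (f := γ)).trans continuousAt_pi
  -- The limit carries the topology induced from the product, and its charts act componentwise near
  -- `t`, so convergence of difference quotients is tested in each component.
  have hslope : ContinuousAt γ t → ∀ w : M.modelInf,
      (Tendsto (slope (fun s => chartAt M.modelInf (γ t) (γ s)) t) (𝓝[≠] t) (𝓝 w) ↔
        ∀ i, HasDerivAt (extChartAt (M.T (i + 1)).I ((γ t).1 i) ∘ fun s => (γ s).1 i) (w.1 i) t) := by
    intro hc w
    rw [Topology.IsInducing.subtypeVal.tendsto_nhds_iff, tendsto_pi_nhds]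
    refine forall_congr' fun i => ?_
    rw [hasDerivAt_iff_tendsto_slope]
    refine tendsto_congr' ?_
    have hsrc : ∀ᶠ s in 𝓝 t, (γ s).1 0 ∈ (extChartAt (M.T 1).I ((γ t).1 0)).source :=
      (hcont.1 hc 0).eventually (extChartAt_source_mem_nhds (I := (M.T 1).I) ((γ t).1 0))
    filter_upwards [hsrc.filter_mono nhdsWithin_le_nhds] with s hs
    have ht := hsrc.self_of_nhds
    have e1 := chartAt_apply hs i
    have e2 := chartAt_apply ht i
    simp only [slope_def_module, Function.comp_apply]
    rw [← e1, ← e2]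
    rfl
  constructor
  · rintro ⟨-, hc, w, hw, hlim⟩ i
    rw [VectorField.isTangentAt_iff]
    refine ⟨hcont.1 hc i, ?_⟩
    have h := (hslope hc w).1 hlim i
    rw [hw i] at h
    exact h
  · intro h
    have hc : ContinuousAt γ t := hcont.2 fun i => (h i).continuousAt
    have hd := fun i => ((iteratedLift X i).isTangentAt_iff.1 (h i)).2
    have hsrc : ∀ᶠ s in 𝓝 t, (γ s).1 0 ∈ (extChartAt (M.T 1).I ((γ t).1 0)).source :=
      (hcont.1 hc 0).eventually (extChartAt_source_mem_nhds (I := (M.T 1).I) ((γ t).1 0))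
    refine ⟨fun i => (iteratedLift X i).proj_toHom _, hc,
      ⟨fun i => coord ((liftInf X (γ t)).1 i), fun i => ?_⟩, fun i => rfl, ?_⟩
    -- The coordinates of the velocities form a point of the model space: in charts `Dπ_i` is the
    -- linear map `modelDproj`, which sends the derivative of component `i + 1` to that of component
    -- `i`.
    · refine HasDerivAt.unique (((modelDproj (M.T i)).hasFDerivAt.comp_hasDerivAt t
        (hd (i + 1))).congr_of_eventuallyEq ?_) (hd i)
      filter_upwards [hsrc] with s hs
      have e := (chartAt M.modelInf (γ t) (γ s)).2 i
      rw [chartAt_apply hs, chartAt_apply hs] at e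
      exact e.symm
    · exact (hslope hc _).2 hd

theorem isIntegralCurveFromInf_iff (X : VectorField (M.T 1)) (ξ : M.TTInf) {γ : ℝ → M.TTInf}
    {J : Set ℝ} : IsIntegralCurveFromInf (liftInf X) ξ γ J ↔
      ∀ i, (iteratedLift X i).IsIntegralCurveFrom (ξ.1 i) (fun t => (γ t).1 i) J := by
  simp only [VectorField.isIntegralCurveFrom_iff]
  refine ⟨fun h i => ⟨h.1, h.2, h.3, congrArg (fun η : M.TTInf => η.1 i) h.4,
    fun t ht => (hasVelocityAt_liftInf_iff X).1 (h.5 t ht) i⟩, fun h => ⟨(h 0).1, (h 0).2.1,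
      (h 0).2.2.1, Subtype.ext (funext fun i => (h i).2.2.2.1),
      fun t ht => (hasVelocityAt_liftInf_iff X).2 fun i => (h i).2.2.2.2 t ht⟩⟩

/-- `X^{c_{i+1}}` and `X^{c_i}` are `Dπ_i`-related, so the projected trajectory is an integral curve
through `ξ_i`, and uniqueness identifies it with the flow. -/
theorem Dπ_flow [T2Space M] (X : VectorField (M.T 1)) (ξ : M.TTInf) {t : ℝ}
    (ht : t ∈ lifetimeInf X ξ) (i : ℕ) :
    M.Dπ i ((iteratedLift X (i + 1)).flow (ξ.1 (i + 1)) t) = (iteratedLift X i).flow (ξ.1 i) t := by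
  have := T.t2Space M (i + 1)
  have := T.t2Space M (i + 2)
  have h := ((iteratedLift X (i + 1)).isIntegralCurveFrom_flow (ξ.1 (i + 1))).map
    (A' := iteratedLift X i) (f := M.Dπ i) (fun η => DD_π_completeLift (iteratedLift X i) η)
  rw [ξ.2 i] at h
  exact (h.flow_eqOn (ht (i + 1))).symm

open Classical in
/-- The limit `lim F^{c_i}_{ξ_i}` of the flows of the iterated complete lifts. -/
noncomputable def flowInf [T2Space M] (X : VectorField (M.T 1)) (ξ : M.TTInf) (t : ℝ) : M.TTInf :=
  if h : t ∈ lifetimeInf X ξ then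
    ⟨fun i => (iteratedLift X i).flow (ξ.1 i) t, Dπ_flow X ξ h⟩
  else ξ

theorem flowInf_apply [T2Space M] (X : VectorField (M.T 1)) (ξ : M.TTInf) {t : ℝ}
    (ht : t ∈ lifetimeInf X ξ) (i : ℕ) :
    (flowInf X ξ t).1 i = (iteratedLift X i).flow (ξ.1 i) t := by
  rw [flowInf, dif_pos ht]

theorem VectorField.IsIntegralCurveFrom.congr {N : BanachManifold.{u}} {A : VectorField N} {x : N}
    {γ γ' : ℝ → N} {J : Set ℝ} (h : A.IsIntegralCurveFrom x γ J) (he : EqOn γ' γ J) :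
    A.IsIntegralCurveFrom x γ' J :=
  A.isIntegralCurveFrom_iff.2 ⟨h.isOpen, h.ordConnected, h.zero_mem,
    (he h.zero_mem).trans h.initial, fun t ht => (h.isTangentAt t ht).congr
      (he.eventuallyEq_of_mem (h.isOpen.mem_nhds ht))⟩

theorem isIntegralCurveFrom_flowInf [T2Space M] (X : VectorField (M.T 1)) (ξ : M.TTInf) (i : ℕ) :
    (iteratedLift X i).IsIntegralCurveFrom (ξ.1 i) (fun t => (flowInf X ξ t).1 i)
      (lifetimeInf X ξ) := by
  have := T.t2Space M (i + 1)
  have h := (iteratedLift X i).isIntegralCurveFrom_flow (ξ.1 i)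
  have hl : (iteratedLift X i).lifetime (ξ.1 i) ⊇ lifetimeInf X ξ := fun t ht => ht i
  have ho : IsOpen (lifetimeInf X ξ) := lifetimeInf_eq X ξ ▸ X.isOpen_lifetime _
  have hc : (lifetimeInf X ξ).OrdConnected := lifetimeInf_eq X ξ ▸ X.ordConnected_lifetime _
  have h0 : 0 ∈ lifetimeInf X ξ := lifetimeInf_eq X ξ ▸ X.zero_mem_lifetime _
  refine VectorField.IsIntegralCurveFrom.congr (γ := (iteratedLift X i).flow (ξ.1 i))
    ((iteratedLift X i).isIntegralCurveFrom_iff.2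
      ⟨ho, hc, h0, h.initial, fun t ht => h.isTangentAt t (hl ht)⟩) fun t ht => ?_
  exact flowInf_apply X ξ ht i

theorem isIntegralCurveFromInf_flowInf [T2Space M] (X : VectorField (M.T 1)) (ξ : M.TTInf) :
    IsIntegralCurveFromInf (liftInf X) ξ (flowInf X ξ) (lifetimeInf X ξ) :=
  (isIntegralCurveFromInf_iff X ξ).2 (isIntegralCurveFrom_flowInf X ξ)

theorem smoothOnInf_flowInf [T2Space M] (X : VectorField (M.T 1)) (ξ : M.TTInf) :
    SmoothOnInf (flowInf X ξ) (lifetimeInf X ξ) := fun i _ ht =>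
  have h := isIntegralCurveFrom_flowInf X ξ i
  ((iteratedLift X i).contMDiffAt_of_isTangentAt
    (eventually_of_mem (h.isOpen.mem_nhds ht) h.isTangentAt)).contMDiffWithinAt

/-- Uniqueness and maximality are read off component by component, each component being an integral
curve on a Hausdorff Banach manifold. -/
theorem IsIntegralCurveFromInf.eqOn_flowInf [T2Space M] {X : VectorField (M.T 1)} {ξ : M.TTInf}
    {δ : ℝ → M.TTInf} {J : Set ℝ} (h : IsIntegralCurveFromInf (liftInf X) ξ δ J) :
    J ⊆ lifetimeInf X ξ ∧ EqOn δ (flowInf X ξ) J := by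
  rw [isIntegralCurveFromInf_iff] at h
  have hJ : J ⊆ lifetimeInf X ξ := fun t ht i => (h i).subset_lifetime ht
  refine ⟨hJ, fun t ht => Subtype.ext (funext fun i => ?_)⟩
  have := T.t2Space M (i + 1)
  rw [flowInf_apply X ξ (hJ ht)]
  exact ((h i).flow_eqOn ht).symm

theorem isCompleteInf_liftInf [T2Space M] {X : VectorField (M.T 1)} (hX : X.IsComplete) :
    IsCompleteInf (liftInf X) := fun ξ => by
  have := T.t2Space M 1
  have h := isIntegralCurveFromInf_flowInf X ξ
  rw [lifetimeInf_eq, X.isComplete_iff.1 hX] at h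
  exact ⟨_, h⟩

end BanachManifold

theorem mainTheorem5 {E : Type u} [NormedAddCommGroup E] [NormedSpace ℝ E] [CompleteSpace E]
    {M : Type u} [TopologicalSpace M] [T2Space M] [ChartedSpace E M] [IsManifold 𝓘(ℝ, E) ∞ M] :
    -- for every vector field `X` on `TM` and every `ξ = (ξ_i) ∈ T(T^∞M)`: the limit of the integral
    -- curves `F^{c_i}_{ξ_i}` is, on `I(ξ)`, the unique (maximal) integral curve of `X^{c_∞}`
    (∀ (X : ((BanachManifold.of E M).T 1).VectorField) (ξ : (BanachManifold.of E M).TTInf),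
      ∃ γ : ℝ → (BanachManifold.of E M).TTInf,
        (∀ t ∈ BanachManifold.lifetimeInf X ξ, ∀ i,
          (γ t).1 i = (BanachManifold.iteratedLift X i).flow (ξ.1 i) t) ∧
        BanachManifold.IsIntegralCurveFromInf (BanachManifold.liftInf X) ξ γ
          (BanachManifold.lifetimeInf X ξ) ∧
        BanachManifold.SmoothOnInf γ (BanachManifold.lifetimeInf X ξ) ∧
        ∀ (δ : ℝ → (BanachManifold.of E M).TTInf) (J : Set ℝ),
          BanachManifold.IsIntegralCurveFromInf (BanachManifold.liftInf X) ξ δ J →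
            J ⊆ BanachManifold.lifetimeInf X ξ ∧ EqOn δ γ J) ∧
    -- completeness, for a complete vector field on `TM`
    (∀ X : ((BanachManifold.of E M).T 1).VectorField, X.IsComplete →
      BanachManifold.IsCompleteInf (BanachManifold.liftInf X)) ∧
    -- completeness, for a complete vector field on `M` (lifted to `TM` first)
    (∀ Y : ((BanachManifold.of E M).T 0).VectorField, Y.IsComplete →
      BanachManifold.IsCompleteInf (BanachManifold.liftInf (BanachManifold.completeLift Y))) := by
  have : T2Space (BanachManifold.of E M) := inferInstanceAs (T2Space M)
  refine ⟨fun X ξ => ⟨BanachManifold.flowInf X ξ, fun t ht i => BanachManifold.flowInf_apply X ξ ht i,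
    BanachManifold.isIntegralCurveFromInf_flowInf X ξ, BanachManifold.smoothOnInf_flowInf X ξ,
    fun δ J h => h.eqOn_flowInf⟩, fun X hX => BanachManifold.isCompleteInf_liftInf hX,
    fun Y hY => BanachManifold.isCompleteInf_liftInf (BanachManifold.IsComplete.completeLift hY)⟩
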